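/- Let $\Gamma$ be a finite connected simplicial graph of girth at least $6$ (trees, having infinite girth, are allowed), with maximum degree $\Delta(\Gamma)$. Let $A(\Gamma)=\langle V(\Gamma)\mid uv=vu \text{ for } \{u,v\}\in E(\Gamma)\rangle$ be its right-angled Artin group, and write $x^g=g^{-1}xg$. The extension graph $\Gamma^e$ has vertex set $\{v^g : v\in V(\Gamma),\ g\in A(\Gamma)\}$, two distinct vertices being adjacent if and only if they commute; $A(\Gamma)$ acts on it on the right by $x\mapsto x^g$. Let $\Gamma^g\subseteq\Gamma^e$ be the subgraph induced on $\{v^g: v\in V(\Gamma)\}$; in particular $\Gamma=\Gamma^1\subseteq\Gamma^e$. *Definitions.* Let a group $G$ act simplicially on a connected $\delta$-hyperbolic graph $\mathcal G$ (for some $\delta$). An element $g$ is *loxodromic* if $\lim_n d(x,g^nx)/n>0$. An *axial subgraph* of $g$ is a nonempty locally finite subgraph of $\mathcal G$ that is $\langle g\rangle$-invariant, on which $\langle g\rangle$ acts cocompactly, and that is weakly convex (any two of its vertices are joined by a geodesic of $\mathcal G$ contained in it). A finite set $S$ of vertices of a subgraph $\mathcal A$ *separates the ends* of $\mathcal A$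 if $\mathcal A$ has at least two ends and any two distinct ends lie in different components of $\mathcal A\setminus S$; the *width* of $\mathcal A$ is the minimal cardinality of such a set. The action has the *$\kappa$-finiteness property* ($\kappa\ge 1$ an integer) if every loxodromic has an axial subgraph of width at most $\kappa$. A *syllable* is a nonzero power of a vertex in $A(\Gamma)$; the *syllable length* of $g$ is the least number of syllables with product $g$; a *syllable decomposition* $g=s_n\cdots s_1$ is a product of that least number of syllables; $g$ is *cyclically syllable-reduced* if its syllable length is minimal in its conjugacy class. For a syllable decomposition $g=s_n\cdots s_1$ with $n\geq 1$ and $m=nq+r$, $0\le r<n$, put $g(m)=s_r\cdots s_1\,g^q$, and $$\mathcal A_{s_n\cdots s_1}=\bigcup_{m\in\mathbb Z}\Gamma^{g(m)} .$$ **Theorem.** 1. There is a positive integer $\kappa\le\max\{1,\Delta(\Gamma)\}$ such that the action of $A(\Gamma)$ on $\Gamma^e$ has the $\kappa$-finiteness property; this includes that the action is simplicial and that $\Gamma^e$ is connected and $\delta$-hyperbolic for some $\delta$. 2. Let $g\in A(\Gamma)$ be a cyclically syllable-reduced loxodromic. - (a) For every syllable decomposition $g=s_n\cdots s_1$, the subgraph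 $\mathcal A_{s_n\cdots s_1}$ is an axial subgraph of $g$. - (b) Let $g=s_n\cdots s_1$ be a syllable decomposition and let $v_i$ be the vertex of which $s_i$ is a power. If $v_1$ is not adjacent to $v_2$, or not adjacent to $v_n$, then the link $\operatorname{lk}_\Gamma(v_1)=\{u\in V(\Gamma):\{u,v_1\}\in E(\Gamma)\}$ separates the ends of $\mathcal A_{s_n\cdots s_1}$. - (c) There is a syllable decomposition $g=s_n\cdots s_1$ such that $\operatorname{lk}_\Gamma(v_1)$ separates the ends of $\mathcal A_{s_n\cdots s_1}$, where $v_1$ is the vertex of which $s_1$ is a power. -/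

import Mathlib

universe u v

/-! ### Groups acting on graphs -/

section Actions

variable {G : Type u} [Group G] {X : Type v} [MulAction G X]

/-- `G` acts on the vertex set of `𝒢` by graph automorphisms. -/
def ActsSimplicially (G : Type u) [Group G] {X : Type v} [MulAction G X]
    (𝒢 : SimpleGraph X) : Prop :=
  ∀ (g : G) (x y : X), 𝒢.Adj (g • x) (g • y) ↔ 𝒢.Adj x y

/-- A walk whose length is the distance between its endpoints. -/
def IsGeodesicWalk {X : Type v} {𝒢 : SimpleGraph X} {x y : X} (p : 𝒢.Walk x y) : Prop :=
  p.length = 𝒢.dist x y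

/-- `𝒢` is connected and every geodesic triangle with corners at vertices is `δ`-slim:
each vertex on a side is within distance `δ` of a vertex on one of the two other sides. -/
def IsDeltaHyperbolic {X : Type v} (𝒢 : SimpleGraph X) (δ : ℕ) : Prop :=
  𝒢.Connected ∧
    ∀ (x y z : X) (p : 𝒢.Walk x y) (q : 𝒢.Walk y z) (r : 𝒢.Walk x z),
      IsGeodesicWalk p → IsGeodesicWalk q → IsGeodesicWalk r →
        ∀ a ∈ p.support, ∃ b, (b ∈ q.support ∨ b ∈ r.support) ∧ 𝒢.dist a b ≤ δ

/-- The asymptotic translation length of `g` exists and equals `τ`: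
`d(x, gⁿ x) / n` tends to `τ` for every vertex `x`. -/
def HasTranslationLength (𝒢 : SimpleGraph X) (g : G) (τ : ℝ) : Prop :=
  ∀ x : X, Filter.Tendsto (fun n : ℕ => (𝒢.dist x (g ^ n • x) : ℝ) / (n : ℝ))
    Filter.atTop (nhds τ)

/-- `g` has positive asymptotic translation length. -/
def IsLoxodromic (𝒢 : SimpleGraph X) (g : G) : Prop :=
  ∃ τ : ℝ, 0 < τ ∧ HasTranslationLength 𝒢 g τ

/-- Any two vertices of `H` are joined by a geodesic of `𝒢` that is contained in `H`. -/
def IsWeaklyConvex {X : Type v} {𝒢 : SimpleGraph X} (H : 𝒢.Subgraph) : Prop :=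
  ∀ x ∈ H.verts, ∀ y ∈ H.verts, ∃ p : 𝒢.Walk x y, IsGeodesicWalk p ∧ p.toSubgraph ≤ H

/-- `H` is an axial subgraph of `g`: a (nonempty) weakly convex, locally finite,
`⟨g⟩`-invariant subgraph on which `⟨g⟩` acts cocompactly.  As `H` is locally finite,
cocompactness amounts to the existence of a finite set of vertices whose `⟨g⟩`-translates
cover all vertices. -/
structure IsAxialSubgraph (𝒢 : SimpleGraph X) (g : G) (H : 𝒢.Subgraph) : Prop where
  nonempty : H.verts.Nonempty
  weaklyConvex : IsWeaklyConvex H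
  locallyFinite : ∀ x ∈ H.verts, (H.neighborSet x).Finite
  verts_invariant : ∀ x, g • x ∈ H.verts ↔ x ∈ H.verts
  adj_invariant : ∀ x y, H.Adj (g • x) (g • y) ↔ H.Adj x y
  cocompact : ∃ F : Set X, F.Finite ∧ F ⊆ H.verts ∧
    ∀ x ∈ H.verts, ∃ k : ℤ, ∃ y ∈ F, x = g ^ k • y

/-- The finite set `S` of vertices of `H` separates the ends of `H`: the graph `H` has at least
two ends, and any two distinct ends of `H` lie in different components of `H` minus `S`. -/
def SeparatesEnds {X : Type v} {𝒢 : SimpleGraph X} (H : 𝒢.Subgraph) (S : Set X) : Prop :=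
  ∃ T : Finset H.verts, Subtype.val '' (T : Set H.verts) = S ∧
    (H.coe.end).Nontrivial ∧
    ∀ e ∈ H.coe.end, ∀ e' ∈ H.coe.end, e ≠ e' → e (Opposite.op T) ≠ e' (Opposite.op T)

/-- The minimal cardinality of a set of vertices separating the ends of `H`
(`⊤` if there is none). -/
noncomputable def endWidth {X : Type v} {𝒢 : SimpleGraph X} (H : 𝒢.Subgraph) : ℕ∞ :=
  ⨅ (S : Set X) (_ : SeparatesEnds H S), S.encard

/-- The `κ`-finiteness property: `G` acts simplicially on the hyperbolic graph `𝒢`, `κ` is a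
positive integer, and every loxodromic has an axial subgraph of width at most `κ`. -/
structure HasKappaFiniteness (G : Type u) [Group G] {X : Type v} [MulAction G X]
    (𝒢 : SimpleGraph X) (κ : ℕ) : Prop where
  simplicial : ActsSimplicially G 𝒢
  hyperbolic : ∃ δ : ℕ, IsDeltaHyperbolic 𝒢 δ
  pos : 0 < κ
  axial : ∀ g : G, IsLoxodromic 𝒢 g →
    ∃ H : 𝒢.Subgraph, IsAxialSubgraph 𝒢 g H ∧ endWidth H ≤ (κ : ℕ∞)

end Actions

/-! ### Right-angled Artin groups and extension graphs -/

section RightAngledArtin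

variable {V : Type u} {Γ : SimpleGraph V}

/-- The right-angled Artin group `A(Γ)`: generated by the vertices, adjacent vertices commute. -/
abbrev RAAG (Γ : SimpleGraph V) : Type u :=
  PresentedGroup {r : FreeGroup V | ∃ a b : V, Γ.Adj a b ∧ 
    r = FreeGroup.of a * FreeGroup.of b * (FreeGroup.of a)⁻¹ * (FreeGroup.of b)⁻¹}

/-- The generator of `A(Γ)` given by a vertex. -/
def RAAG.gen (Γ : SimpleGraph V) (a : V) : RAAG Γ := PresentedGroup.of a

/-- The vertices of the extension graph: all conjugates `v ^ g = g⁻¹ v g` in `A(Γ)`. -/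
def ExtVertex (Γ : SimpleGraph V) : Type u :=
  {x : RAAG Γ // ∃ (a : V) (g : RAAG Γ), x = g⁻¹ * RAAG.gen Γ a * g}

/-- The vertex `v ^ g = g⁻¹ v g` of the extension graph. -/
def conjVertex (Γ : SimpleGraph V) (a : V) (g : RAAG Γ) : ExtVertex Γ :=
  ⟨g⁻¹ * RAAG.gen Γ a * g, a, g, rfl⟩

/-- The extension graph `Γ^e`: two distinct conjugates of vertices are adjacent if and only if
they commute in `A(Γ)`. -/
def extensionGraph (Γ : SimpleGraph V) : SimpleGraph (ExtVertex Γ) where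
  Adj x y := x ≠ y ∧ Commute x.1 y.1
  symm := ⟨fun _ _ h => ⟨h.1.symm, h.2.symm⟩⟩
  loopless := ⟨fun _ h => h.1 rfl⟩

/-- The right action `x ↦ x ^ g = g⁻¹ x g` of `A(Γ)` on the vertices of `Γ^e`, as an action of
the opposite group. -/
instance ExtVertex.instMulAction (Γ : SimpleGraph V) :
    MulAction (RAAG Γ)ᵐᵒᵖ (ExtVertex Γ) where
  smul g x := ⟨g.unop⁻¹ * x.1 * g.unop, by
    obtain ⟨a, h, hx⟩ := x.2
    exact ⟨a, h * g.unop, by rw [hx]; group⟩⟩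
  one_smul x := Subtype.ext (by
    change (1 : RAAG Γ)⁻¹ * x.1 * 1 = x.1
    group)
  mul_smul g h x := Subtype.ext (by
    change (h.unop * g.unop)⁻¹ * x.1 * (h.unop * g.unop)
      = g.unop⁻¹ * (h.unop⁻¹ * x.1 * h.unop) * g.unop
    group)

/-- `Γ^g`, the subgraph of `Γ^e` induced on `{v ^ g | v ∈ V(Γ)}`. -/
def translateGraph (Γ : SimpleGraph V) (g : RAAG Γ) : (extensionGraph Γ).Subgraph :=
  (⊤ : (extensionGraph Γ).Subgraph).induce (Set.range fun a : V => conjVertex Γ a g)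

/-- The vertices of the link `lk_Γ(a)`, inside `Γ ⊆ Γ^e`. -/
def linkSet (Γ : SimpleGraph V) (a : V) : Set (ExtVertex Γ) :=
  (fun b : V => conjVertex Γ b 1) '' Γ.neighborSet a

/-! A list `[(v₁, k₁), …, (vₙ, kₙ)]` with all `kᵢ ≠ 0` stands for the syllables `sᵢ = vᵢ ^ kᵢ`
and the product `sₙ ⋯ s₁`. -/

/-- The product `sₙ ⋯ s₁` of the list `[s₁, …, sₙ]`. -/
def syllableProd (Γ : SimpleGraph V) (w : List (V × ℤ)) : RAAG Γ :=
  (w.reverse.map fun s => RAAG.gen Γ s.1 ^ s.2).prod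

/-- The least number of syllables whose product is `g`. -/
noncomputable def syllableLength (g : RAAG Γ) : ℕ :=
  sInf {n : ℕ | ∃ w : List (V × ℤ), (∀ s ∈ w, s.2 ≠ 0) ∧ syllableProd Γ w = g ∧ w.length = n}

/-- `g = sₙ ⋯ s₁` is a syllable decomposition: a product of the minimal number of syllables. -/
structure IsSyllableDecomposition (w : List (V × ℤ)) (g : RAAG Γ) : Prop where
  exponent_ne_zero : ∀ s ∈ w, s.2 ≠ 0
  prod_eq : syllableProd Γ w = g
  length_eq : w.length = syllableLength g

/-- `g` has minimal syllable length in its conjugacy class. -/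
def IsCyclicallySyllableReduced (g : RAAG Γ) : Prop :=
  ∀ h : RAAG Γ, syllableLength g ≤ syllableLength (h⁻¹ * g * h)

/-- `g(m) = s_r ⋯ s₁ g ^ q`, where `g = sₙ ⋯ s₁` and `m = n q + r` with `0 ≤ r < n`. -/
def partialPower (Γ : SimpleGraph V) (w : List (V × ℤ)) (m : ℤ) : RAAG Γ :=
  syllableProd Γ (w.take (m % (w.length : ℤ)).toNat) *
    syllableProd Γ w ^ (m / (w.length : ℤ))

/-- The union over all `m ∈ ℤ` of the subgraphs `Γ^{g(m)}`. -/
def axialUnion (Γ : SimpleGraph V) (w : List (V × ℤ)) : (extensionGraph Γ).Subgraph :=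
  ⨆ m : ℤ, translateGraph Γ (partialPower Γ w m)

end RightAngledArtin

/-! ### Right-angled Artin groups -/

namespace RAAG

variable {V : Type u} {Γ : SimpleGraph V}

/-! Every vertex v defines a wall. The function `side Γ v` on A(Γ) changes under left multiplication
by a generator only if that generator is v and the current element lies in the star group of v; it
is well defined because it comes from an action of A(Γ) on A(Γ) × ℤ. On Γ^e, the value of `side Γ v
(h * k⁻¹)` at u^h is well defined and locally constant off the closed star of v^k, so a walk that
changes sides must meet this star (`exists_mem_support_commute`). The same function controls normal
forms: on a reduced word it reads off the exponent of the rightmost syllable. Hence vertex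
centralizers are star groups (`mem_starGroup_iff`), and every edge of Γ^e lies in a translate Γ^g. A
reduced word thus yields a chain of translates, consecutive ones agreeing on a closed star, whose
walls are met by every walk between the two ends of the chain.

Hyperbolicity needs only this: the wall vertices of the chain lie near all sides of a triangle that
connect its ends, and consecutive ones are at bounded distance. Girth enters in weak convexity. A
geodesic that meets a wall outside the current translate would have done better to pass through the
wall vertex (`dist_add_one_le_of_commute`), so geodesics can be rerouted through the chain
(`exists_geodesic_of_reducedWord`).

For a cyclically reduced loxodromic, all windows of its periodic bi-infinite word are reduced, since
no power fixes a vertex. The translates along this word form a line of finite connected graphs, and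
a set separating its two directions separates the ends (`ends_of_line`). If v₁ is not adjacent to
the vertex of a neighbouring syllable, absence of squares confines the contact between the wall of
v₁ and the line in that direction to the link (`adj_and_eq_of_commute`, `separatesEnds_link`).
Absence of triangles lets one exchange s₁ and s₂ when needed to reach this situation. The width is
then at most the degree of v₁. -/

theorem gen_commute {a b : V} (h : Γ.Adj a b) : Commute (gen Γ a) (gen Γ b) := by
  have h1 := PresentedGroup.one_of_mem
    (rels := {r : FreeGroup V | ∃ a b : V, Γ.Adj a b ∧
      r = FreeGroup.of a * FreeGroup.of b * (FreeGroup.of a)⁻¹ * (FreeGroup.of b)⁻¹})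
    ⟨a, b, h, rfl⟩
  have h2 : gen Γ a * gen Γ b * (gen Γ a)⁻¹ * (gen Γ b)⁻¹ = 1 := h1
  rwa [mul_inv_eq_one, mul_inv_eq_iff_eq_mul] at h2

/-- The homomorphism from `A(Γ)` given by a map on vertices that respects the relations. -/
def lift {H : Type*} [Group H] (φ : V → H) (hφ : ∀ a b, Γ.Adj a b → Commute (φ a) (φ b)) :
    RAAG Γ →* H :=
  PresentedGroup.toGroup (f := φ) (by
    rintro r ⟨a, b, hab, rfl⟩
    simp only [map_mul, map_inv, FreeGroup.lift_apply_of]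
    rw [mul_inv_eq_one, mul_inv_eq_iff_eq_mul]
    exact hφ a b hab)

@[simp]
theorem lift_gen {H : Type*} [Group H] (φ : V → H)
    (hφ : ∀ a b, Γ.Adj a b → Commute (φ a) (φ b)) (a : V) : lift φ hφ (gen Γ a) = φ a :=
  PresentedGroup.toGroup.of _

open Classical in
/-- The total exponent of the vertex `v`. -/
noncomputable def exponentSum (Γ : SimpleGraph V) (v : V) : RAAG Γ →* Multiplicative ℤ :=
  lift (fun a => if a = v then Multiplicative.ofAdd 1 else 1) fun _ _ _ => Commute.all _ _

/-- Exponent sums are invariant under conjugation. -/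
theorem eq_of_conj_eq {a b : V} {g h : RAAG Γ}
    (e : g⁻¹ * gen Γ a * g = h⁻¹ * gen Γ b * h) : a = b := by
  by_contra hab
  have := congrArg (exponentSum Γ b) e
  simp [exponentSum, hab] at this
  exact absurd (Multiplicative.ofAdd.injective (this.symm.trans ofAdd_zero.symm)) one_ne_zero

/-- The vertex `a` lies in the closed star of `v`. -/
def InStar (Γ : SimpleGraph V) (v a : V) : Prop := a = v ∨ Γ.Adj v a

theorem InStar.refl (v : V) : InStar Γ v v := Or.inl rfl

theorem InStar.symm {v a : V} (h : InStar Γ v a) : InStar Γ a v := by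
  rcases h with h | h
  · exact Or.inl h.symm
  · exact Or.inr h.symm

theorem InStar.gen_commute {v a : V} (h : InStar Γ v a) : Commute (gen Γ v) (gen Γ a) := by
  rcases h with rfl | h
  · exact Commute.refl _
  · exact RAAG.gen_commute h

/-- The subgroup generated by the closed star of `v`. -/
def starGroup (Γ : SimpleGraph V) (v : V) : Subgroup (RAAG Γ) :=
  Subgroup.closure (gen Γ '' {a | InStar Γ v a})

theorem gen_mem_starGroup {v a : V} (h : InStar Γ v a) : gen Γ a ∈ starGroup Γ v :=
  Subgroup.subset_closure ⟨a, h, rfl⟩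

theorem zpow_mem_starGroup {v a : V} (h : InStar Γ v a) (k : ℤ) :
    gen Γ a ^ k ∈ starGroup Γ v :=
  zpow_mem (gen_mem_starGroup h) k

theorem commute_of_mem_starGroup {v : V} {c : RAAG Γ} (hc : c ∈ starGroup Γ v) :
    Commute c (gen Γ v) := by
  induction hc using Subgroup.closure_induction with
  | mem x hx => obtain ⟨a, ha, rfl⟩ := hx; exact InStar.gen_commute ha.symm
  | one => exact Commute.one_left _
  | mul x y _ _ hx hy => exact hx.mul_left hy
  | inv x _ hx => exact hx.inv_left

open Classical in
/-- The action of a generator on `A(Γ) × ℤ` that records crossings of the wall of `v`. -/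
noncomputable def wallPerm (Γ : SimpleGraph V) (v a : V) : Equiv.Perm (RAAG Γ × ℤ) where
  toFun p := (gen Γ a * p.1, p.2 + if a = v ∧ p.1 ∈ starGroup Γ v then 1 else 0)
  invFun p := ((gen Γ a)⁻¹ * p.1,
    p.2 - if a = v ∧ (gen Γ a)⁻¹ * p.1 ∈ starGroup Γ v then 1 else 0)
  left_inv p := by simp
  right_inv p := by simp

open Classical in
/-- `A(Γ)` acts on `A(Γ) × ℤ`, the second coordinate counting crossings of the wall of `v`. -/
noncomputable def wallAction (Γ : SimpleGraph V) (v : V) : RAAG Γ →* Equiv.Perm (RAAG Γ × ℤ) :=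
  lift (wallPerm Γ v) (by
    intro a b hab
    refine Equiv.ext fun p => ?_
    have hc : gen Γ a * gen Γ b = gen Γ b * gen Γ a := gen_commute hab
    simp only [Equiv.Perm.mul_apply, wallPerm, Equiv.coe_fn_mk, ← mul_assoc, hc, Prod.mk.injEq,
      true_and]
    have hne := hab.ne
    -- If one of the commuting letters is v, the other lies in the star group of v, so multiplying
    -- by it does not affect whether the wall is crossed.
    by_cases ha : a = v
    · subst ha
      simp only [hne.symm, false_and, if_false, add_zero]
      exact congrArg (p.2 + ·) (if_congr (and_congr_right fun _ =>
        Subgroup.mul_mem_cancel_left _ (gen_mem_starGroup (Or.inr hab))) rfl rfl)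
    · by_cases hb : b = v
      · subst hb
        simp only [hne, false_and, if_false, add_zero]
        exact congrArg (p.2 + ·) (if_congr (and_congr_right fun _ =>
          (Subgroup.mul_mem_cancel_left _ (gen_mem_starGroup (Or.inr hab.symm))).symm) rfl rfl)
      · simp [ha, hb])

theorem wallAction_gen (v a : V) : wallAction Γ v (gen Γ a) = wallPerm Γ v a :=
  lift_gen _ _ a

theorem wallAction_fst (v : V) (g : RAAG Γ) (p : RAAG Γ × ℤ) :
    (wallAction Γ v g p).1 = g * p.1 := by
  induction g using PresentedGroup.induction_on with
  | _ z =>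
    induction z using FreeGroup.induction_on generalizing p with
    | C1 => simp
    | of a =>
      change (wallAction Γ v (gen Γ a) p).1 = gen Γ a * p.1
      rw [wallAction_gen]
      rfl
    | inv_of a h =>
      rw [map_inv, map_inv, eq_inv_mul_iff_mul_eq, ← h, ← Equiv.Perm.mul_apply, mul_inv_cancel,
        Equiv.Perm.one_apply]
    | mul x y hx hy => rw [map_mul, map_mul, Equiv.Perm.mul_apply, hx, hy, mul_assoc]

/-- The side of the wall of `v` on which `g` lies: the exponent of `v` in the part of `g` that
can be moved to the right end up to letters of the link of `v`. -/
noncomputable def side (Γ : SimpleGraph V) (v : V) (g : RAAG Γ) : ℤ := (wallAction Γ v g (1, 0)).2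

@[simp]
theorem side_one (v : V) : side Γ v 1 = 0 := by simp [side]

open Classical in
theorem side_gen_mul (v a : V) (g : RAAG Γ) :
    side Γ v (gen Γ a * g) = side Γ v g + if a = v ∧ g ∈ starGroup Γ v then 1 else 0 := by
  have h := wallAction_fst v g (1, 0)
  rw [mul_one] at h
  simp only [side, map_mul, Equiv.Perm.mul_apply]
  rw [wallAction_gen]
  simp only [wallPerm, Equiv.coe_fn_mk]
  rw [h]

theorem side_gen_mul_of_not {v a : V} {g : RAAG Γ} (h : ¬ (a = v ∧ g ∈ starGroup Γ v)) :
    side Γ v (gen Γ a * g) = side Γ v g := by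
  rw [side_gen_mul, if_neg h, add_zero]

theorem side_zpow_mul_of_not {v a : V} {g : RAAG Γ} (h : ¬ (a = v ∧ g ∈ starGroup Γ v)) (k : ℤ) :
    side Γ v (gen Γ a ^ k * g) = side Γ v g := by
  have key : ∀ k : ℤ, ¬ (a = v ∧ gen Γ a ^ k * g ∈ starGroup Γ v) := by
    rintro k ⟨rfl, hk⟩
    exact h ⟨rfl, (Subgroup.mul_mem_cancel_left _ (zpow_mem_starGroup (InStar.refl a) k)).1 hk⟩
  induction k using Int.induction_on with
  | zero => simp
  | succ i ih => rw [add_comm, zpow_add, zpow_one, mul_assoc, side_gen_mul_of_not (key _), ih]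
  | pred i ih =>
    rw [← ih, ← side_gen_mul_of_not (key (-(i : ℤ) - 1)), ← mul_assoc, ← zpow_one_add]
    congr 3; ring

theorem side_zpow_mul_self {v : V} {g : RAAG Γ} (h : g ∈ starGroup Γ v) (k : ℤ) :
    side Γ v (gen Γ v ^ k * g) = side Γ v g + k := by
  have key : ∀ k : ℤ, gen Γ v ^ k * g ∈ starGroup Γ v :=
    fun k => mul_mem (zpow_mem_starGroup (InStar.refl v) k) h
  have step : ∀ k : ℤ, side Γ v (gen Γ v ^ (k + 1) * g) = side Γ v (gen Γ v ^ k * g) + 1 := by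
    intro k
    rw [add_comm, zpow_add, zpow_one, mul_assoc, side_gen_mul, if_pos ⟨rfl, key k⟩]
  induction k using Int.induction_on with
  | zero => simp
  | succ i ih => rw [step, ih]; ring
  | pred i ih => have := step (-(i : ℤ) - 1); rw [sub_add_cancel, ih] at this; linarith

theorem side_zpow_self (v : V) (k : ℤ) : side Γ v (gen Γ v ^ k) = k := by
  simpa using side_zpow_mul_self (one_mem (starGroup Γ v)) k

/-- Left multiplication by the star group of `u` does not change the side of the wall of `v`,
if it does not meet the star group of `v`. -/
theorem side_mul_of_forall_not {u v : V} {c g : RAAG Γ} (hc : c ∈ starGroup Γ u)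
    (h : InStar Γ u v → ∀ c ∈ starGroup Γ u, c * g ∉ starGroup Γ v) :
    side Γ v (c * g) = side Γ v g := by
  induction hc using Subgroup.closure_induction generalizing g with
  | mem x hx =>
    obtain ⟨a, ha, rfl⟩ := hx
    refine side_gen_mul_of_not ?_
    rintro ⟨rfl, hg⟩
    exact h ha 1 (one_mem _) (by simpa using hg)
  | one => simp
  | mul x y hx hy ihx ihy =>
    have hy' : ∀ c ∈ starGroup Γ u, c * y ∈ starGroup Γ u := fun c hc => mul_mem hc hy
    rw [mul_assoc, ihx, ihy h]
    intro hv c hc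
    rw [← mul_assoc]
    exact h hv _ (hy' c hc)
  | inv x hx ih =>
    have := @ih (x⁻¹ * g) (by
      intro hv c hc
      rw [← mul_assoc]
      exact h hv _ (mul_mem hc (inv_mem hx)))
    rw [← this, mul_inv_cancel_left]

theorem side_eq_zero_of_mem_starGroup {u v : V} {c : RAAG Γ} (hc : c ∈ starGroup Γ u)
    (h : ¬ InStar Γ u v) : side Γ v c = 0 := by
  have := side_mul_of_forall_not (g := 1) hc (fun hv => absurd hv h)
  simpa using this

/-- Right multiplication by the star group of `v` shifts the side of the wall of `v`. -/
theorem side_mul_of_mem_starGroup {v : V} {c : RAAG Γ} (hc : c ∈ starGroup Γ v) (g : RAAG Γ) :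
    side Γ v (g * c) = side Γ v g + side Γ v c := by
  -- Membership in the star group is insensitive to right multiplication by c, so g and g c receive
  -- the same increments.
  have step : ∀ (a : V) (g : RAAG Γ), side Γ v (gen Γ a * g * c) - side Γ v (gen Γ a * g)
      = side Γ v (g * c) - side Γ v g := by
    intro a g
    rw [mul_assoc, side_gen_mul, side_gen_mul, Subgroup.mul_mem_cancel_right _ hc]
    ring
  suffices h : ∀ g' : RAAG Γ, side Γ v (g * g' * c) - side Γ v (g * g')
      = side Γ v (g' * c) - side Γ v g' by
    have := h 1
    simp only [mul_one, one_mul, side_one] at this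
    linarith
  induction g using PresentedGroup.induction_on with
  | _ z =>
    induction z using FreeGroup.induction_on with
    | C1 => simp
    | of a => exact fun g' => step a g'
    | inv_of a h =>
      intro g'
      have := h (PresentedGroup.mk _ (FreeGroup.of a)⁻¹ * g')
      rw [map_inv, mul_inv_cancel_left] at this
      rw [map_inv, this]
    | mul x y hx hy =>
      intro g'
      rw [map_mul, mul_assoc _ _ g', hx, hy]

theorem side_mul_zpow_self (v : V) (g : RAAG Γ) (k : ℤ) :
    side Γ v (g * gen Γ v ^ k) = side Γ v g + k := by
  rw [side_mul_of_mem_starGroup (zpow_mem_starGroup (InStar.refl v) k), side_zpow_self]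

theorem side_mul_zpow_of_adj {v a : V} (h : Γ.Adj v a) (g : RAAG Γ) (k : ℤ) :
    side Γ v (g * gen Γ a ^ k) = side Γ v g := by
  rw [side_mul_of_mem_starGroup (zpow_mem_starGroup (Or.inr h) k)]
  have : side Γ v (gen Γ a ^ k * 1) = side Γ v 1 :=
    side_zpow_mul_of_not (fun h' => h.ne h'.1.symm) k
  rw [mul_one] at this
  rw [this, side_one, add_zero]

end RAAG

/-! ### Reduced words -/

namespace RAAG

variable {V : Type u} {Γ : SimpleGraph V}

@[simp]
theorem syllableProd_nil : syllableProd Γ [] = 1 := rfl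

@[simp]
theorem syllableProd_cons (s : V × ℤ) (t : List (V × ℤ)) :
    syllableProd Γ (s :: t) = syllableProd Γ t * gen Γ s.1 ^ s.2 := by
  simp [syllableProd]

@[simp]
theorem syllableProd_append (l t : List (V × ℤ)) :
    syllableProd Γ (l ++ t) = syllableProd Γ t * syllableProd Γ l := by
  simp [syllableProd]

/-- The inverse word. -/
def invWord (w : List (V × ℤ)) : List (V × ℤ) := w.reverse.map fun s => (s.1, -s.2)

@[simp]
theorem syllableProd_invWord (w : List (V × ℤ)) :
    syllableProd Γ (invWord w) = (syllableProd Γ w)⁻¹ := by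
  induction w with
  | nil => simp [invWord]
  | cons s t ih =>
    have : invWord (s :: t) = invWord t ++ [(s.1, -s.2)] := by simp [invWord]
    rw [this, syllableProd_append, ih]
    simp

/-- No syllable of `t` at the vertex `v` can be moved to the head of `t`. -/
def Unreachable (Γ : SimpleGraph V) (v : V) : List (V × ℤ) → Prop
  | [] => True
  | s :: t => s.1 ≠ v ∧ (Γ.Adj v s.1 → Unreachable Γ v t)

/-- No two syllables of the word can be merged after exchanging commuting syllables. -/
def ReducedWord (Γ : SimpleGraph V) : List (V × ℤ) → Prop
  | [] => True
  | s :: t => s.2 ≠ 0 ∧ Unreachable Γ s.1 t ∧ ReducedWord Γ t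

theorem unreachable_append {v : V} {l t : List (V × ℤ)} :
    Unreachable Γ v (l ++ t) ↔
      Unreachable Γ v l ∧ ((∀ s ∈ l, Γ.Adj v s.1) → Unreachable Γ v t) := by
  induction l with
  | nil => simp [Unreachable]
  | cons s l ih =>
    simp only [List.cons_append, Unreachable, ih, List.mem_cons, forall_eq_or_imp]
    tauto

theorem unreachable_map {v : V} {l : List (V × ℤ)} {f : V × ℤ → V × ℤ} (hf : ∀ s, (f s).1 = s.1) :
    Unreachable Γ v (l.map f) ↔ Unreachable Γ v l := by
  induction l with
  | nil => simp [Unreachable]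
  | cons s l ih => simp only [List.map_cons, Unreachable, ih, hf]

theorem ReducedWord.of_append_right {l t : List (V × ℤ)} (h : ReducedWord Γ (l ++ t)) :
    ReducedWord Γ t := by
  induction l with
  | nil => exact h
  | cons s l ih => exact ih h.2.2

theorem ReducedWord.of_append_left {l t : List (V × ℤ)} (h : ReducedWord Γ (l ++ t)) :
    ReducedWord Γ l := by
  induction l with
  | nil => trivial
  | cons s l ih => exact ⟨h.1, (unreachable_append.1 h.2.1).1, ih h.2.2⟩

/-- Being reduced is symmetric under reversal: a mergeable pair can be detected from either of its
members. This is what makes inverse words reduced. -/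
theorem ReducedWord.append_singleton {l : List (V × ℤ)} {s : V × ℤ} (h : ReducedWord Γ l)
    (hs : s.2 ≠ 0) (hu : Unreachable Γ s.1 l.reverse) : ReducedWord Γ (l ++ [s]) := by
  induction l with
  | nil => exact ⟨hs, trivial, trivial⟩
  | cons a l ih =>
    rw [List.reverse_cons, unreachable_append] at hu
    refine ⟨h.1, unreachable_append.2 ⟨h.2.1, fun hl => ⟨fun e => ?_, fun _ => trivial⟩⟩,
      ih h.2.2 hu.1⟩
    refine (hu.2 fun r hr => ?_).1 e.symm
    rw [e]
    exact hl r (List.mem_reverse.1 hr)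

theorem ReducedWord.invWord {w : List (V × ℤ)} (h : ReducedWord Γ w) :
    ReducedWord Γ (invWord w) := by
  induction w with
  | nil => trivial
  | cons s t ih =>
    have : RAAG.invWord (s :: t) = RAAG.invWord t ++ [(s.1, -s.2)] := by simp [RAAG.invWord]
    rw [this]
    refine (ih h.2.2).append_singleton (neg_ne_zero.2 h.1) ?_
    rw [RAAG.invWord, ← List.map_reverse, List.reverse_reverse]
    exact (unreachable_map (f := fun s => (s.1, -s.2)) fun _ => rfl).2 h.2.1

/-- The two claims feed each other in an induction on length: a syllable outside the star is
detected by its own wall, and a wall can be crossed only at a partial product in its star group. -/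
theorem side_eq_zero_and_inStar_of_reducedWord (n : ℕ) :
    (∀ (v : V) (t : List (V × ℤ)), t.length ≤ n → ReducedWord Γ t →
      syllableProd Γ t ∈ starGroup Γ v → ∀ s ∈ t, InStar Γ v s.1) ∧
    (∀ (v : V) (t : List (V × ℤ)), t.length ≤ n → ReducedWord Γ t → Unreachable Γ v t →
      side Γ v (syllableProd Γ t) = 0) := by
  induction n with
  | zero =>
    refine ⟨fun v t ht => ?_, fun v t ht => ?_⟩ <;>
    · rw [List.length_eq_zero_iff.1 (Nat.le_zero.1 ht)]
      simp
  | succ n ih =>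
    refine ⟨fun v t ht hr hm => ?_, fun v t ht hr hu => ?_⟩
    · rcases t with - | ⟨s, t⟩
      · simp
      have ht' : t.length ≤ n := by simpa using ht
      by_cases hs : InStar Γ v s.1
      · rw [syllableProd_cons, Subgroup.mul_mem_cancel_right _ (zpow_mem_starGroup hs _)] at hm
        exact List.forall_mem_cons.2 ⟨hs, ih.1 v t ht' hr.2.2 hm⟩
      -- The wall of the rightmost syllable sees exactly its exponent, whereas it sees nothing of
      -- the star group of v.
      · have h1 := side_eq_zero_of_mem_starGroup hm hs
        rw [syllableProd_cons, side_mul_zpow_self, ih.2 s.1 t ht' hr.2.2 hr.2.1, zero_add] at h1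
        exact absurd h1 hr.1
    · rcases t with - | ⟨s, t⟩
      · simp
      have ht' : t.length ≤ n := by simpa using ht
      by_cases hs : Γ.Adj v s.1
      · rw [syllableProd_cons, side_mul_zpow_of_adj hs]
        exact ih.2 v t ht' hr.2.2 (hu.2 hs)
      -- Now syllables are stripped from the left end. A crossing would need the remaining product,
      -- which still contains s, in the star group of v; the first claim forbids this.
      · have hs' : ¬ InStar Γ v s.1 := fun h => h.elim hu.1 hs
        clear hu
        induction t using List.reverseRecOn with
        | nil => simpa using side_zpow_mul_of_not (g := 1) (fun h => hs' (Or.inl h.1)) s.2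
        | append_singleton r a ihr =>
          rw [← List.cons_append] at hr ⊢
          have hlen : r.length ≤ n := by simp at ht'; lia
          have hlen' : (s :: r).length ≤ n := by simp at ht' ⊢; lia
          rw [syllableProd_append, syllableProd_cons, syllableProd_nil, one_mul,
            side_zpow_mul_of_not, ihr (by simpa using hlen) hr.of_append_left hlen]
          rintro ⟨-, hmem⟩
          exact hs' (ih.1 v _ hlen' hr.of_append_left hmem s (by simp))

theorem ReducedWord.inStar {v : V} {t : List (V × ℤ)} (ht : ReducedWord Γ t)
    (h : syllableProd Γ t ∈ starGroup Γ v) : ∀ s ∈ t, InStar Γ v s.1 :=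
  (side_eq_zero_and_inStar_of_reducedWord t.length).1 v t le_rfl ht h

theorem ReducedWord.side_eq_zero {v : V} {t : List (V × ℤ)} (ht : ReducedWord Γ t)
    (h : Unreachable Γ v t) : side Γ v (syllableProd Γ t) = 0 :=
  (side_eq_zero_and_inStar_of_reducedWord t.length).2 v t le_rfl ht h

theorem ReducedWord.side_cons {s : V × ℤ} {t : List (V × ℤ)} (h : ReducedWord Γ (s :: t)) :
    side Γ s.1 (syllableProd Γ (s :: t)) = s.2 := by
  rw [syllableProd_cons, side_mul_zpow_self, h.2.2.side_eq_zero h.2.1, zero_add]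

theorem syllableProd_mem_starGroup {v : V} {t : List (V × ℤ)} (h : ∀ s ∈ t, InStar Γ v s.1) :
    syllableProd Γ t ∈ starGroup Γ v := by
  induction t with
  | nil => exact one_mem _
  | cons s t ih =>
    rw [List.forall_mem_cons] at h
    rw [syllableProd_cons]
    exact mul_mem (ih h.2) (zpow_mem_starGroup h.1 _)

theorem exists_eq_mul_zpow_of_not_unreachable {v : V} {t : List (V × ℤ)}
    (ht : ∀ s ∈ t, s.2 ≠ 0) (h : ¬ Unreachable Γ v t) :
    ∃ (k : ℤ) (t' : List (V × ℤ)), (∀ s ∈ t', s.2 ≠ 0) ∧ t'.length < t.length ∧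
      syllableProd Γ t = syllableProd Γ t' * gen Γ v ^ k := by
  induction t with
  | nil => exact absurd trivial h
  | cons s t ih =>
    rw [List.forall_mem_cons] at ht
    by_cases hs : s.1 = v
    · exact ⟨s.2, t, ht.2, by simp, by rw [syllableProd_cons, hs]⟩
    · simp only [Unreachable, not_and, Classical.not_imp] at h
      obtain ⟨hadj, hu⟩ := h hs
      obtain ⟨k, t', h1, h2, h3⟩ := ih ht.2 hu
      refine ⟨k, s :: t', List.forall_mem_cons.2 ⟨ht.1, h1⟩, by simpa using h2, ?_⟩
      rw [syllableProd_cons, syllableProd_cons, h3, mul_assoc, mul_assoc,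
        ((gen_commute hadj).zpow_zpow k s.2).eq]

/-- A syllable that can be moved next to one at the same vertex merges with it or cancels it, so
minimal length implies reduced. -/
theorem exists_shorter_of_not_reducedWord {t : List (V × ℤ)} (ht : ∀ s ∈ t, s.2 ≠ 0)
    (h : ¬ ReducedWord Γ t) :
    ∃ t' : List (V × ℤ), (∀ s ∈ t', s.2 ≠ 0) ∧ t'.length < t.length ∧
      syllableProd Γ t' = syllableProd Γ t := by
  induction t with
  | nil => exact absurd trivial h
  | cons s t ih =>
    rw [List.forall_mem_cons] at ht
    by_cases hr : ReducedWord Γ t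
    · have hu : ¬ Unreachable Γ s.1 t := fun hu => h ⟨ht.1, hu, hr⟩
      obtain ⟨k, t', h1, h2, h3⟩ := exists_eq_mul_zpow_of_not_unreachable ht.2 hu
      by_cases hk : k + s.2 = 0
      · refine ⟨t', h1, h2.trans (by simp), ?_⟩
        rw [syllableProd_cons, h3, mul_assoc, ← zpow_add, hk, zpow_zero, mul_one]
      · refine ⟨(s.1, k + s.2) :: t', List.forall_mem_cons.2 ⟨hk, h1⟩, by simpa using h2, ?_⟩
        rw [syllableProd_cons, syllableProd_cons, h3, mul_assoc, ← zpow_add]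
    · obtain ⟨t', h1, h2, h3⟩ := ih ht.2 hr
      exact ⟨s :: t', List.forall_mem_cons.2 ⟨ht.1, h1⟩, by simpa using h2, by simp [h3]⟩

theorem exists_word (g : RAAG Γ) :
    ∃ t : List (V × ℤ), (∀ s ∈ t, s.2 ≠ 0) ∧ syllableProd Γ t = g := by
  induction g using PresentedGroup.induction_on with
  | _ z =>
    induction z using FreeGroup.induction_on with
    | C1 => exact ⟨[], by simp, by simp⟩
    | of a => exact ⟨[(a, 1)], by simp, by simp [gen, PresentedGroup.of, PresentedGroup.mk]⟩
    | inv_of a _ => exact ⟨[(a, -1)], by simp, by simp [gen, PresentedGroup.of, PresentedGroup.mk]⟩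
    | mul x y hx hy =>
      obtain ⟨t, h1, h2⟩ := hx
      obtain ⟨t', h1', h2'⟩ := hy
      refine ⟨t' ++ t, ?_, by simp [h2, h2']⟩
      intro s hs
      rcases List.mem_append.1 hs with h | h
      exacts [h1' s h, h1 s h]

theorem exists_isSyllableDecomposition (g : RAAG Γ) :
    ∃ w : List (V × ℤ), IsSyllableDecomposition w g := by
  obtain ⟨t, h1, h2⟩ := exists_word g
  obtain ⟨w, h3, h4, h5⟩ := Nat.sInf_mem (s := {n : ℕ | ∃ w : List (V × ℤ), (∀ s ∈ w, s.2 ≠ 0) ∧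
    syllableProd Γ w = g ∧ w.length = n}) ⟨_, t, h1, h2, rfl⟩
  exact ⟨w, h3, h4, h5⟩

theorem syllableLength_le {w : List (V × ℤ)} (hw : ∀ s ∈ w, s.2 ≠ 0) :
    syllableLength (syllableProd Γ w) ≤ w.length :=
  Nat.sInf_le ⟨w, hw, rfl, rfl⟩

theorem reducedWord_of_length_le {w : List (V × ℤ)} (hw : ∀ s ∈ w, s.2 ≠ 0)
    (h : w.length ≤ syllableLength (syllableProd Γ w)) : ReducedWord Γ w := by
  by_contra hr
  obtain ⟨t, h1, h2, h3⟩ := exists_shorter_of_not_reducedWord hw hr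
  have := syllableLength_le (Γ := Γ) h1
  rw [h3] at this
  lia

theorem _root_.IsSyllableDecomposition.reducedWord {w : List (V × ℤ)} {g : RAAG Γ}
    (h : IsSyllableDecomposition w g) : ReducedWord Γ w :=
  reducedWord_of_length_le h.exponent_ne_zero (by rw [h.prod_eq, h.length_eq])

/-- No syllable at a vertex of the closed star of `u` can be moved to the end of the word. -/
def LeftReduced (Γ : SimpleGraph V) (u : V) : List (V × ℤ) → Prop
  | [] => True
  | s :: t => ¬ (InStar Γ u s.1 ∧ ∀ r ∈ t, InStar Γ s.1 r.1) ∧ LeftReduced Γ u t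

theorem exists_shorter_of_not_leftReduced {u : V} {t : List (V × ℤ)} (ht : ∀ s ∈ t, s.2 ≠ 0)
    (h : ¬ LeftReduced Γ u t) :
    ∃ t' : List (V × ℤ), (∀ s ∈ t', s.2 ≠ 0) ∧ t'.length < t.length ∧
      syllableProd Γ t * (syllableProd Γ t')⁻¹ ∈ starGroup Γ u := by
  induction t with
  | nil => exact absurd trivial h
  | cons s t ih =>
    rw [List.forall_mem_cons] at ht
    by_cases hr : LeftReduced Γ u t
    · have hu : InStar Γ u s.1 ∧ ∀ r ∈ t, InStar Γ s.1 r.1 := by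
        by_contra hu
        exact h ⟨hu, hr⟩
      refine ⟨t, ht.2, by simp, ?_⟩
      have hc := (commute_of_mem_starGroup (syllableProd_mem_starGroup hu.2)).zpow_right s.2
      rw [syllableProd_cons, hc.eq, mul_inv_cancel_right]
      exact zpow_mem_starGroup hu.1 _
    · obtain ⟨t', h1, h2, h3⟩ := ih ht.2 hr
      refine ⟨s :: t', List.forall_mem_cons.2 ⟨ht.1, h1⟩, by simpa using h2, ?_⟩
      rw [syllableProd_cons, syllableProd_cons]
      convert h3 using 1
      group

/-- Every element has a reduced representative modulo the star group of `u` on the left. -/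
theorem exists_leftReduced (u : V) (g : RAAG Γ) :
    ∃ e : List (V × ℤ), ReducedWord Γ e ∧ LeftReduced Γ u e ∧
      g * (syllableProd Γ e)⁻¹ ∈ starGroup Γ u := by
  obtain ⟨t, h1, rfl⟩ := exists_word g
  induction hn : t.length using Nat.strong_induction_on generalizing t with
  | _ n ih =>
    subst hn
    by_cases hr : ReducedWord Γ t
    · by_cases hl : LeftReduced Γ u t
      · exact ⟨t, hr, hl, by simp⟩
      · obtain ⟨t', h1', h2, h3⟩ := exists_shorter_of_not_leftReduced h1 hl
        obtain ⟨e, he, hle, hm⟩ := ih _ h2 t' h1' rfl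
        refine ⟨e, he, hle, ?_⟩
        convert mul_mem h3 hm using 1
        group
    · obtain ⟨t', h1', h2, h3⟩ := exists_shorter_of_not_reducedWord h1 hr
      obtain ⟨e, he, hle, hm⟩ := ih _ h2 t' h1' rfl
      exact ⟨e, he, hle, h3 ▸ hm⟩

/-- A syllable of e that commutes past the rest of e is not in the star of u, so it is blocked at
the syllable of u and cannot reach anything in t. -/
theorem ReducedWord.append_of_leftReduced {u : V} {k : ℤ} {e t : List (V × ℤ)}
    (he : ReducedWord Γ e) (hl : LeftReduced Γ u e) (ht : ReducedWord Γ ((u, k) :: t)) :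
    ReducedWord Γ (e ++ (u, k) :: t) := by
  induction e with
  | nil => exact ht
  | cons s e ih =>
    refine ⟨he.1, unreachable_append.2 ⟨he.2.1, fun ha => ?_⟩, ih he.2.2 hl.2⟩
    have hs : ¬ InStar Γ u s.1 := fun hs => hl.1 ⟨hs, fun r hr => Or.inr (ha r hr)⟩
    exact ⟨fun h => hs (Or.inl h.symm), fun h => absurd (Or.inr h.symm) hs⟩

/-- The word for the conjugate of `u` by the product of `e`. -/
def conjWord (u : V) (e : List (V × ℤ)) : List (V × ℤ) := e ++ (u, 1) :: invWord e

theorem syllableProd_conjWord (u : V) (e : List (V × ℤ)) :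
    syllableProd Γ (conjWord u e) = (syllableProd Γ e)⁻¹ * gen Γ u * syllableProd Γ e := by
  simp [conjWord]

/-- The right half is the inverse of e followed by u⁻¹, so the junction lemma applies on both sides
of u. -/
theorem reducedWord_conjWord {u : V} {e : List (V × ℤ)} (he : ReducedWord Γ e)
    (hl : LeftReduced Γ u e) : ReducedWord Γ (conjWord u e) := by
  refine he.append_of_leftReduced hl ?_
  have h : ReducedWord Γ ((u, (-1 : ℤ)) :: []) := ⟨by simp, trivial, trivial⟩
  have := (he.append_of_leftReduced hl h).invWord
  simpa [RAAG.invWord] using this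

/-- The first syllable of the reduced conjugate has nonzero side at its own wall, but the element u
crosses only the wall of u. So this syllable is a power of u and can be stripped. -/
theorem syllableProd_mem_starGroup_of_conj_eq {u : V} {e : List (V × ℤ)} (he : ReducedWord Γ e)
    (hl : LeftReduced Γ u e)
    (h : (syllableProd Γ e)⁻¹ * gen Γ u * syllableProd Γ e = gen Γ u) :
    syllableProd Γ e ∈ starGroup Γ u := by
  induction e with
  | nil => exact one_mem _
  | cons s e ih =>
    have h1 : side Γ s.1 (gen Γ u) = s.2 := by
      rw [← h, ← syllableProd_conjWord]
      exact (reducedWord_conjWord he hl).side_cons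
    have hsu : s.1 = u := by
      by_contra hne
      have : side Γ s.1 (gen Γ u * 1) = side Γ s.1 1 := side_gen_mul_of_not fun h => hne h.1.symm
      rw [mul_one, side_one] at this
      exact he.1 (h1.symm.trans this)
    rw [syllableProd_cons, hsu] at h ⊢
    refine mul_mem (ih he.2.2 hl.2 ?_) (zpow_mem_starGroup (InStar.refl u) _)
    have hc : Commute (gen Γ u) (gen Γ u ^ s.2) := (Commute.refl _).zpow_right _
    calc (syllableProd Γ e)⁻¹ * gen Γ u * syllableProd Γ e
        = gen Γ u ^ s.2 * ((syllableProd Γ e * gen Γ u ^ s.2)⁻¹ * gen Γ u *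
          (syllableProd Γ e * gen Γ u ^ s.2)) * (gen Γ u ^ s.2)⁻¹ := by group
      _ = gen Γ u := by rw [h, ← hc.eq, mul_inv_cancel_right]

/-- The centralizer of a vertex is generated by its closed star. -/
theorem mem_starGroup_iff {u : V} {g : RAAG Γ} :
    g ∈ starGroup Γ u ↔ Commute g (gen Γ u) := by
  refine ⟨commute_of_mem_starGroup, fun h => ?_⟩
  obtain ⟨e, he, hl, hm⟩ := exists_leftReduced u g
  have hc : Commute (syllableProd Γ e) (gen Γ u) := by
    simpa using (commute_of_mem_starGroup hm).inv_left.mul_left h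
  have := syllableProd_mem_starGroup_of_conj_eq he hl
    (by rw [mul_assoc, ← hc.eq, inv_mul_cancel_left])
  simpa using mul_mem hm this

theorem conj_eq_conj_iff {u : V} {g h : RAAG Γ} :
    g⁻¹ * gen Γ u * g = h⁻¹ * gen Γ u * h ↔ g * h⁻¹ ∈ starGroup Γ u := by
  rw [mem_starGroup_iff, commute_iff_eq]
  constructor <;> intro e
  · have := congrArg (fun x => g * x * h⁻¹) e
    simpa [mul_assoc] using this.symm
  · have := congrArg (fun x => g⁻¹ * x * h) e
    simpa [mul_assoc] using this.symm

/-- If `u ^ e` with `e` reduced commutes with a vertex `w`, all syllables of `e` lie in the star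
of `w`. -/
theorem inStar_of_commute_conj {u w : V} {e : List (V × ℤ)} (he : ReducedWord Γ e)
    (hl : LeftReduced Γ u e)
    (h : Commute ((syllableProd Γ e)⁻¹ * gen Γ u * syllableProd Γ e) (gen Γ w)) :
    InStar Γ w u ∧ ∀ s ∈ e, InStar Γ w s.1 := by
  rw [← mem_starGroup_iff, ← syllableProd_conjWord] at h
  have := (reducedWord_conjWord he hl).inStar h
  simp only [conjWord, List.mem_append, List.mem_cons] at this
  exact ⟨this (u, 1) (by simp), fun s hs => this s (Or.inl hs)⟩

/-- A conjugate of `u` that commutes with `w` is conjugate to `u` by an element of the star group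
of `w`. -/
theorem exists_conj_of_commute {u w : V} {g : RAAG Γ}
    (h : Commute (g⁻¹ * gen Γ u * g) (gen Γ w)) :
    InStar Γ w u ∧ ∃ e : List (V × ℤ), ReducedWord Γ e ∧ LeftReduced Γ u e ∧
      g * (syllableProd Γ e)⁻¹ ∈ starGroup Γ u ∧ ∀ s ∈ e, InStar Γ w s.1 := by
  obtain ⟨e, he, hl, hm⟩ := exists_leftReduced u g
  rw [conj_eq_conj_iff.2 hm] at h
  obtain ⟨h1, h2⟩ := inStar_of_commute_conj he hl h
  exact ⟨h1, e, he, hl, hm, h2⟩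

end RAAG

/-! ### The extension graph -/

section ExtensionGraph

open RAAG

variable {V : Type u} {Γ : SimpleGraph V}

theorem conjVertex_eq_iff {u : V} {g h : RAAG Γ} :
    conjVertex Γ u g = conjVertex Γ u h ↔ g * h⁻¹ ∈ starGroup Γ u := by
  rw [← conj_eq_conj_iff]
  exact Subtype.ext_iff

theorem conjVertex_mul_of_mem {u : V} {c : RAAG Γ} (hc : c ∈ starGroup Γ u) (g : RAAG Γ) :
    conjVertex Γ u (c * g) = conjVertex Γ u g :=
  conjVertex_eq_iff.2 (by simpa using hc)

theorem ExtVertex.exists_eq (x : ExtVertex Γ) : ∃ u g, x = conjVertex Γ u g := by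
  obtain ⟨u, g, h⟩ := x.2
  exact ⟨u, g, Subtype.ext h⟩

/-- The vertex of `Γ` to which a vertex of the extension graph is conjugate. -/
noncomputable def vertexType (x : ExtVertex Γ) : V := x.exists_eq.choose

@[simp]
theorem vertexType_conjVertex (u : V) (g : RAAG Γ) : vertexType (conjVertex Γ u g) = u := by
  obtain ⟨h, e⟩ := (conjVertex Γ u g).exists_eq.choose_spec
  exact (eq_of_conj_eq (congrArg Subtype.val e)).symm

theorem eq_of_conjVertex_eq {u w : V} {g h : RAAG Γ} (e : conjVertex Γ u g = conjVertex Γ w h) :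
    u = w := by
  simpa using congrArg vertexType e

theorem conjVertex_injective (g : RAAG Γ) : Function.Injective fun u => conjVertex Γ u g :=
  fun _ _ h => eq_of_conjVertex_eq h

theorem commute_conj_iff {x y g : RAAG Γ} :
    Commute (g⁻¹ * x * g) (g⁻¹ * y * g) ↔ Commute x y := by
  rw [commute_iff_eq, commute_iff_eq]
  constructor <;> intro e
  · have := congrArg (fun z => g * z * g⁻¹) e
    simpa [mul_assoc] using this
  · have := congrArg (fun z => g⁻¹ * z * g) e
    simpa [mul_assoc] using this

theorem commute_conjVertex_iff {u w : V} {g : RAAG Γ} :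
    Commute (conjVertex Γ u g).1 (conjVertex Γ w g).1 ↔ InStar Γ w u := by
  refine (commute_conj_iff (g := g)).trans ⟨fun h => ?_, fun h => h.gen_commute.symm⟩
  exact (exists_conj_of_commute (g := 1) (by simpa using h)).1

theorem adj_conjVertex_iff {u w : V} {g : RAAG Γ} :
    (extensionGraph Γ).Adj (conjVertex Γ u g) (conjVertex Γ w g) ↔ Γ.Adj u w := by
  refine (and_congr (conjVertex_injective g).ne_iff commute_conjVertex_iff).trans ?_
  constructor
  · rintro ⟨h1, h2 | h2⟩
    exacts [absurd h2 h1, h2.symm]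
  · exact fun h => ⟨h.ne, Or.inr h.symm⟩

/-- Commuting vertices of the extension graph are simultaneously conjugate to vertices of `Γ`. -/
theorem exists_conjVertex_of_commute {u w : V} {g h : RAAG Γ}
    (hc : Commute (conjVertex Γ u g).1 (conjVertex Γ w h).1) :
    InStar Γ w u ∧ ∃ e : List (V × ℤ), ReducedWord Γ e ∧ LeftReduced Γ u e ∧
      (∀ s ∈ e, InStar Γ w s.1) ∧ conjVertex Γ u g = conjVertex Γ u (syllableProd Γ e * h) := by
  have h1 : Commute ((g * h⁻¹)⁻¹ * gen Γ u * (g * h⁻¹)) (gen Γ w) := by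
    rw [← commute_conj_iff (g := h)]
    have e : h⁻¹ * ((g * h⁻¹)⁻¹ * gen Γ u * (g * h⁻¹)) * h = (conjVertex Γ u g).1 := by
      simp [conjVertex, mul_assoc]
    rw [e]
    exact hc
  obtain ⟨h2, e, he, hl, hm, hs⟩ := exists_conj_of_commute h1
  refine ⟨h2, e, he, hl, hs, conjVertex_eq_iff.2 ?_⟩
  simpa [mul_assoc] using hm

theorem exists_conjVertex_of_adj {x y : ExtVertex Γ} (h : (extensionGraph Γ).Adj x y) :
    ∃ u w g, Γ.Adj u w ∧ x = conjVertex Γ u g ∧ y = conjVertex Γ w g := by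
  obtain ⟨u, g, rfl⟩ := x.exists_eq
  obtain ⟨w, k, rfl⟩ := y.exists_eq
  obtain ⟨-, e, -, -, he, h2⟩ := exists_conjVertex_of_commute h.2
  have h3 := conjVertex_mul_of_mem (syllableProd_mem_starGroup he) k
  refine ⟨u, w, syllableProd Γ e * k, ?_, h2, h3.symm⟩
  rw [h2, ← h3] at h
  exact adj_conjVertex_iff.1 h

/-- The retraction of the extension graph onto `Γ`. -/
noncomputable def typeHom (Γ : SimpleGraph V) : extensionGraph Γ →g Γ where
  toFun := vertexType
  map_rel' h := by
    obtain ⟨u, w, g, hadj, rfl, rfl⟩ := exists_conjVertex_of_adj h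
    simpa using hadj

/-- The embedding of `Γ` onto `Γ ^ g`. -/
def conjHom (Γ : SimpleGraph V) (g : RAAG Γ) : Γ →g extensionGraph Γ where
  toFun u := conjVertex Γ u g
  map_rel' h := adj_conjVertex_iff.2 h

/-- For a syllable s, the translates Γ^g and Γ^{sg} share the vertex carrying s, so the syllables of
any word link up translates. -/
theorem extensionGraph_connected (hconn : Γ.Connected) : (extensionGraph Γ).Connected := by
  have h1 : ∀ (g : RAAG Γ) (u w : V),
      (extensionGraph Γ).Reachable (conjVertex Γ u g) (conjVertex Γ w g) :=
    fun g u w => (hconn u w).map (conjHom Γ g)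
  have h2 : ∀ (t : List (V × ℤ)) (g : RAAG Γ) (u w : V), (extensionGraph Γ).Reachable
      (conjVertex Γ u g) (conjVertex Γ w (syllableProd Γ t * g)) := by
    intro t
    induction t with
    | nil => simpa using h1
    | cons s t ih =>
      intro g u w
      have h3 := ih (gen Γ s.1 ^ s.2 * g) s.1 w
      rw [conjVertex_mul_of_mem (zpow_mem_starGroup (InStar.refl _) _)] at h3
      rw [syllableProd_cons, mul_assoc]
      exact (h1 g u s.1).trans h3
  have := hconn.nonempty
  refine (SimpleGraph.connected_iff _).2 ⟨fun x y => ?_, ⟨conjVertex Γ (Classical.arbitrary V) 1⟩⟩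
  obtain ⟨u, g, rfl⟩ := x.exists_eq
  obtain ⟨w, h, rfl⟩ := y.exists_eq
  obtain ⟨t, -, ht⟩ := exists_word (h * g⁻¹)
  have := h2 t g u w
  rwa [ht, inv_mul_cancel_right] at this

/-- The retraction `typeHom` maps walks to walks of the same length. -/
theorem dist_vertexType_le (hconn : Γ.Connected) (x y : ExtVertex Γ) :
    Γ.dist (vertexType x) (vertexType y) ≤ (extensionGraph Γ).dist x y := by
  obtain ⟨p, hp⟩ := (extensionGraph_connected hconn).exists_walk_length_eq_dist x y
  rw [← hp, ← p.length_map (typeHom Γ)]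
  exact SimpleGraph.dist_le _

theorem exists_geodesic_in_translateGraph (hconn : Γ.Connected) {g : RAAG Γ} {x y : ExtVertex Γ}
    (hx : x ∈ (translateGraph Γ g).verts) (hy : y ∈ (translateGraph Γ g).verts) :
    ∃ p : (extensionGraph Γ).Walk x y, IsGeodesicWalk p ∧ p.toSubgraph ≤ translateGraph Γ g := by
  obtain ⟨u, rfl⟩ := hx
  obtain ⟨w, rfl⟩ := hy
  obtain ⟨p, hp⟩ := hconn.exists_walk_length_eq_dist u w
  change ∃ p : (extensionGraph Γ).Walk (conjHom Γ g u) (conjHom Γ g w),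
    IsGeodesicWalk p ∧ p.toSubgraph ≤ translateGraph Γ g
  refine ⟨p.map (conjHom Γ g), ?_, ?_⟩
  · refine le_antisymm ?_ (SimpleGraph.dist_le _)
    rw [SimpleGraph.Walk.length_map, hp]
    have := dist_vertexType_le hconn (conjVertex Γ u g) (conjVertex Γ w g)
    rwa [vertexType_conjVertex, vertexType_conjVertex] at this
  · rw [SimpleGraph.Walk.toSubgraph_map]
    refine ⟨?_, ?_⟩
    · rintro _ ⟨a, -, rfl⟩
      exact ⟨a, rfl⟩
    · rintro _ _ ⟨a, b, hab, rfl, rfl⟩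
      exact ⟨⟨a, rfl⟩, ⟨b, rfl⟩, (conjHom Γ g).map_adj hab.adj_sub⟩

theorem dist_conjVertex (hconn : Γ.Connected) (g : RAAG Γ) (u w : V) :
    (extensionGraph Γ).dist (conjVertex Γ u g) (conjVertex Γ w g) = Γ.dist u w := by
  have h := dist_vertexType_le hconn (conjVertex Γ u g) (conjVertex Γ w g)
  rw [vertexType_conjVertex, vertexType_conjVertex] at h
  refine le_antisymm ?_ h
  obtain ⟨p, hp⟩ := hconn.exists_walk_length_eq_dist u w
  rw [← hp, ← p.length_map (conjHom Γ g)]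
  exact SimpleGraph.dist_le _

theorem dist_le_one_of_commute {x y : ExtVertex Γ} (h : Commute x.1 y.1) :
    (extensionGraph Γ).dist x y ≤ 1 := by
  by_cases hxy : x = y
  · simp [hxy]
  · have hadj : (extensionGraph Γ).Adj x y := ⟨hxy, h⟩
    exact (SimpleGraph.dist_eq_one_iff_adj.2 hadj).le

/-! ### Walls -/

/-- Two representatives differ by an element of the star group of u on the left. This could change
the side only by passing through the star group of v, and then u^g would commute with v^k. -/
theorem side_eq_of_conjVertex_eq {u u' v : V} {g g' k : RAAG Γ}
    (h : ¬ Commute (conjVertex Γ u g).1 (conjVertex Γ v k).1)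
    (e : conjVertex Γ u g = conjVertex Γ u' g') : side Γ v (g * k⁻¹) = side Γ v (g' * k⁻¹) := by
  obtain rfl := eq_of_conjVertex_eq e
  have hm := conjVertex_eq_iff.1 e
  rw [e] at h
  have := side_mul_of_forall_not (v := v) (g := g' * k⁻¹) hm (fun hv c hc hd => h ?_)
  · rwa [← mul_assoc, inv_mul_cancel_right] at this
  · rw [← conjVertex_mul_of_mem hc g', ← conjVertex_mul_of_mem hd k]
    have e2 : c * (g' * k⁻¹) * k = c * g' := by group
    rw [e2]
    exact commute_conjVertex_iff.2 hv.symm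

theorem side_eq_of_walk {v : V} {k : RAAG Γ} {x y : ExtVertex Γ} (p : (extensionGraph Γ).Walk x y)
    (hp : ∀ z ∈ p.support, ¬ Commute z.1 (conjVertex Γ v k).1) {u w : V} {g h : RAAG Γ}
    (hx : x = conjVertex Γ u g) (hy : y = conjVertex Γ w h) :
    side Γ v (g * k⁻¹) = side Γ v (h * k⁻¹) := by
  induction p generalizing u g with
  | nil =>
    subst hx
    exact side_eq_of_conjVertex_eq (hp _ (by simp)) hy
  | cons hadj p ih =>
    obtain ⟨a, b, c, -, h1, h2⟩ := exists_conjVertex_of_adj hadj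
    subst hx
    rw [side_eq_of_conjVertex_eq (hp _ (by simp)) h1]
    exact ih (fun z hz => hp z (by simp [hz])) h2 hy

/-- A walk between vertices on different sides of the wall of `v ^ k` meets the star of `v ^ k`. -/
theorem exists_mem_support_commute {v : V} {k g h : RAAG Γ} {u w : V}
    (hne : side Γ v (g * k⁻¹) ≠ side Γ v (h * k⁻¹))
    (p : (extensionGraph Γ).Walk (conjVertex Γ u g) (conjVertex Γ w h)) :
    ∃ z ∈ p.support, Commute z.1 (conjVertex Γ v k).1 := by
  by_contra! hcon
  exact hne (side_eq_of_walk p hcon rfl rfl)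

theorem RAAG.ReducedWord.side_inv_eq_zero {l : List (V × ℤ)} {s : V × ℤ}
    (h : ReducedWord Γ (l ++ [s])) : side Γ s.1 (syllableProd Γ l)⁻¹ = 0 := by
  have h1 := h.invWord
  have e : RAAG.invWord (l ++ [s]) = (s.1, -s.2) :: RAAG.invWord l := by simp [RAAG.invWord]
  rw [e] at h1
  rw [← syllableProd_invWord]
  exact h1.2.2.side_eq_zero h1.2.1

/-- The wall of each syllable separates the two end translates: the side is zero before the syllable
and equals its exponent from there on. -/
theorem RAAG.ReducedWord.exists_mem_support_commute {l t : List (V × ℤ)} {s : V × ℤ}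
    (hr : ReducedWord Γ (l ++ s :: t)) {u w : V} {g : RAAG Γ} (p : (extensionGraph Γ).Walk
      (conjVertex Γ u g) (conjVertex Γ w (syllableProd Γ (l ++ s :: t) * g))) :
    ∃ z ∈ p.support, Commute z.1 (conjVertex Γ s.1 (syllableProd Γ l * g)).1 := by
  refine _root_.exists_mem_support_commute ?_ p
  have h1 : ReducedWord Γ (l ++ [s]) := by
    rw [← List.singleton_append, ← List.append_assoc] at hr
    exact hr.of_append_left
  have e1 : g * (syllableProd Γ l * g)⁻¹ = (syllableProd Γ l)⁻¹ := by group
  have e2 : syllableProd Γ (l ++ s :: t) * g * (syllableProd Γ l * g)⁻¹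
      = syllableProd Γ (s :: t) := by
    rw [syllableProd_append]
    group
  rw [e1, e2, h1.side_inv_eq_zero, hr.of_append_right.side_cons]
  exact hr.of_append_right.1.symm

/-! ### Hyperbolicity -/

theorem SimpleGraph.Walk.dist_add_dist_le_length {X : Type*} {G : SimpleGraph X} {x y z : X}
    (p : G.Walk x y) (hz : z ∈ p.support) : G.dist x z + G.dist z y ≤ p.length := by
  classical
  have := congrArg SimpleGraph.Walk.length (p.take_spec hz)
  rw [SimpleGraph.Walk.length_append] at this
  rw [← this]
  exact add_le_add (SimpleGraph.dist_le _) (SimpleGraph.dist_le _)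

/-- A discrete intermediate value argument along the wall vertices: the chain starts in P and ends
in Q, and consecutive members lie in a common translate of Γ, hence within D. -/
theorem exists_consecutive_of_chain {D : ℕ}
    (hD : ∀ (g : RAAG Γ) (u w : V),
      (extensionGraph Γ).dist (conjVertex Γ u g) (conjVertex Γ w g) ≤ D)
    {P Q R : ExtVertex Γ → Prop} (t : List (V × ℤ)) (g : RAAG Γ) (u w : V)
    (hPQ : ∀ l s l', t = l ++ s :: l' →
      (P (conjVertex Γ s.1 (syllableProd Γ l * g)) ∨ Q (conjVertex Γ s.1 (syllableProd Γ l * g))) ∧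
        R (conjVertex Γ s.1 (syllableProd Γ l * g)))
    (hP : P (conjVertex Γ u g)) (hR : R (conjVertex Γ u g))
    (hQ : Q (conjVertex Γ w (syllableProd Γ t * g))) :
    ∃ c c', P c ∧ R c ∧ Q c' ∧ (extensionGraph Γ).dist c c' ≤ D := by
  induction t generalizing g u with
  | nil => exact ⟨_, _, hP, hR, hQ, by simpa using hD g u w⟩
  | cons s t ih =>
    have h1 := hPQ [] s t rfl
    rw [syllableProd_nil, one_mul] at h1
    rcases h1 with ⟨h1 | h1, h2⟩
    · have e := conjVertex_mul_of_mem (zpow_mem_starGroup (InStar.refl s.1) s.2) g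
      rw [← e] at h1 h2
      refine ih (gen Γ s.1 ^ s.2 * g) s.1 (fun l r l' hl => ?_) h1 h2 ?_
      · have := hPQ (s :: l) r l' (by rw [hl, List.cons_append])
        rwa [syllableProd_cons, mul_assoc] at this
      · rwa [syllableProd_cons, mul_assoc] at hQ
    · exact ⟨_, _, hP, hR, h1, hD g u s.1⟩

theorem exists_isDeltaHyperbolic_extensionGraph [Finite V] (hconn : Γ.Connected) :
    ∃ δ : ℕ, IsDeltaHyperbolic (extensionGraph Γ) δ := by
  obtain ⟨D, hD⟩ := (Set.finite_range fun x : V × V => Γ.dist x.1 x.2).bddAbove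
  have hD' : ∀ (g : RAAG Γ) (u w : V),
      (extensionGraph Γ).dist (conjVertex Γ u g) (conjVertex Γ w g) ≤ D := by
    intro g u w
    rw [dist_conjVertex hconn]
    exact hD ⟨(u, w), rfl⟩
  -- The constant: wall vertices near the two halves of p at a give points b, b' on these halves
  -- with d(b, b') ≤ D + 2. As p is geodesic, d(a, b) ≤ D + 2, and two more steps lead from b over c
  -- to another side.
  have hc := extensionGraph_connected hconn
  refine ⟨D + 4, hc, fun x y z p q r hp _ _ a ha => ?_⟩
  classical
  obtain ⟨u, g, rfl⟩ := x.exists_eq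
  obtain ⟨w, h, rfl⟩ := y.exists_eq
  obtain ⟨t, ht, hth⟩ := exists_isSyllableDecomposition (h * g⁻¹)
  have hr : ReducedWord Γ t := IsSyllableDecomposition.reducedWord ⟨ht, hth, ‹_›⟩
  obtain rfl : h = syllableProd Γ t * g := by rw [hth, inv_mul_cancel_right]
  let q' := r.append q.reverse
  obtain ⟨c, c', ⟨b, hb, hbc⟩, ⟨d, hd, hdc⟩, ⟨b', hb', hbc'⟩, hcc⟩ :=
    exists_consecutive_of_chain hD'
    (P := fun c => ∃ b ∈ (p.takeUntil a ha).support, (extensionGraph Γ).dist b c ≤ 1)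
    (R := fun c => ∃ b ∈ q'.support, (extensionGraph Γ).dist b c ≤ 1)
    (Q := fun c => ∃ b ∈ (p.dropUntil a ha).support, (extensionGraph Γ).dist b c ≤ 1) t g u w
    (by
      rintro l s l' rfl
      constructor
      · obtain ⟨b, hb, hbc⟩ := hr.exists_mem_support_commute p
        rw [← p.take_spec ha, SimpleGraph.Walk.mem_support_append_iff] at hb
        rcases hb with hb | hb
        · exact Or.inl ⟨b, hb, dist_le_one_of_commute hbc⟩
        · exact Or.inr ⟨b, hb, dist_le_one_of_commute hbc⟩
      · obtain ⟨b, hb, hbc⟩ := hr.exists_mem_support_commute q'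
        exact ⟨b, hb, dist_le_one_of_commute hbc⟩)
    ⟨_, SimpleGraph.Walk.start_mem_support _, by simp⟩
    ⟨_, SimpleGraph.Walk.start_mem_support _, by simp⟩
    ⟨_, SimpleGraph.Walk.end_mem_support _, by simp⟩
  refine ⟨d, ?_, ?_⟩
  · rw [SimpleGraph.Walk.mem_support_append_iff, SimpleGraph.Walk.support_reverse,
      List.mem_reverse] at hd
    exact hd.symm
  · have h1 := SimpleGraph.Walk.dist_add_dist_le_length _ hb
    have h2 := SimpleGraph.Walk.dist_add_dist_le_length _ hb'
    have h3 := congrArg SimpleGraph.Walk.length (p.take_spec ha)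
    rw [SimpleGraph.Walk.length_append, hp] at h3
    have h4 := hc.dist_triangle (u := conjVertex Γ u g) (v := b)
      (w := conjVertex Γ w (syllableProd Γ t * g))
    have h5 := hc.dist_triangle (u := b) (v := b') (w := conjVertex Γ w (syllableProd Γ t * g))
    have h6 := hc.dist_triangle (u := b) (v := c) (w := b')
    have h7 := hc.dist_triangle (u := c) (v := c') (w := b')
    have h8 := hc.dist_triangle (u := a) (v := b) (w := d)
    have h9 := hc.dist_triangle (u := b) (v := c) (w := d)
    rw [(extensionGraph Γ).dist_comm (u := c') (v := b')] at h7
    rw [(extensionGraph Γ).dist_comm (u := c) (v := d)] at h9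
    rw [(extensionGraph Γ).dist_comm (u := a) (v := b)] at h8
    lia

end ExtensionGraph

/-! ### Graphs of girth at least six -/

namespace SimpleGraph

variable {V : Type u} {Γ : SimpleGraph V}

theorem not_triangle_of_six_le_egirth (h : 6 ≤ Γ.egirth) {a b c : V} (h1 : Γ.Adj a b)
    (h2 : Γ.Adj b c) (h3 : Γ.Adj c a) : False := by
  have hc : (Walk.cons h1 (Walk.cons h2 (Walk.cons h3 Walk.nil))).IsCycle := by
    simp [Walk.cons_isCycle_iff, h1.ne, h2.ne, h3.ne, h1.ne', h3.ne']
  have := le_egirth.1 h _ _ hc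
  norm_num at this

theorem eq_of_square_of_six_le_egirth (h : 6 ≤ Γ.egirth) {a b c d : V} (h1 : Γ.Adj a b)
    (h2 : Γ.Adj b c) (h3 : Γ.Adj c d) (h4 : Γ.Adj d a) (hac : a ≠ c) : b = d := by
  by_contra hbd
  have hc : (Walk.cons h1 (Walk.cons h2 (Walk.cons h3 (Walk.cons h4 Walk.nil)))).IsCycle := by
    simp [Walk.cons_isCycle_iff, h1.ne, h2.ne, h3.ne, h4.ne, h1.ne', h4.ne',
      hac, hac.symm, hbd]
  have := le_egirth.1 h _ _ hc
  norm_num at this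

theorem not_pentagon_of_six_le_egirth (h : 6 ≤ Γ.egirth) {a b c d e : V} (h1 : Γ.Adj a b)
    (h2 : Γ.Adj b c) (h3 : Γ.Adj c d) (h4 : Γ.Adj d e) (h5 : Γ.Adj e a) : False := by
  have t := fun {a b c : V} => @not_triangle_of_six_le_egirth V Γ h a b c
  have hac : a ≠ c := by rintro rfl; exact t h3 h4 h5
  have had : a ≠ d := by rintro rfl; exact t h1 h2 h3
  have hbd : b ≠ d := by rintro rfl; exact t h4 h5 h1
  have hbe : b ≠ e := by rintro rfl; exact t h2 h3 h4
  have hce : c ≠ e := by rintro rfl; exact t h5 h1 h2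
  have hc : (Walk.cons h1 (Walk.cons h2 (Walk.cons h3 (Walk.cons h4
      (Walk.cons h5 Walk.nil))))).IsCycle := by
    simp [Walk.cons_isCycle_iff, h1.ne, h2.ne, h3.ne, h4.ne, h5.ne, h1.ne', h5.ne',
      hac, had, hbd, hbe, hce, hac.symm, had.symm]
  have := le_egirth.1 h _ _ hc
  norm_num at this

theorem Connected.two_le_dist (hconn : Γ.Connected) {a b : V} (hne : a ≠ b) (h : ¬ Γ.Adj a b) :
    2 ≤ Γ.dist a b := by
  have h0 := hconn.pos_dist_of_ne hne
  have h1 : Γ.dist a b ≠ 1 := fun e => h (dist_eq_one_iff_adj.1 e)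
  lia

theorem Connected.three_le_dist (hconn : Γ.Connected) {a b : V} (hne : a ≠ b) (h : ¬ Γ.Adj a b)
    (h' : ∀ c, Γ.Adj a c → ¬ Γ.Adj c b) : 3 ≤ Γ.dist a b := by
  obtain ⟨p, hp⟩ := hconn.exists_walk_length_eq_dist a b
  rw [← hp]
  match p with
  | .nil => exact absurd rfl hne
  | .cons h1 .nil => exact absurd h1 h
  | .cons h1 (.cons h2 .nil) => exact absurd h2 (h' _ h1)
  | .cons h1 (.cons h2 (.cons h3 p)) => simp

/-- Without cycles of length at most five, the way from the star of a to another neighbour u of v is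
shortest through v; a pentagon would already be a counterexample. -/
theorem dist_add_one_le_of_six_le_egirth (hconn : Γ.Connected) (h : 6 ≤ Γ.egirth) {u v a q : V}
    (hu : Γ.Adj v u) (ha : Γ.Adj v a) (hua : u ≠ a) (hq : q = a ∨ Γ.Adj a q) :
    Γ.dist q v + 1 ≤ Γ.dist q u := by
  have hau : ¬ Γ.Adj a u := fun h1 => not_triangle_of_six_le_egirth h ha h1 hu.symm
  have d1 : Γ.dist a v = 1 := dist_eq_one_iff_adj.2 ha.symm
  rcases hq with rfl | hq
  · rw [d1]
    exact hconn.two_le_dist hua.symm hau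
  · by_cases hqv : q = v
    · subst hqv
      rw [dist_self]
      exact hconn.pos_dist_of_ne hu.ne
    · have h2 : Γ.dist q v ≤ 2 := by
        have := hconn.dist_triangle (u := q) (v := a) (w := v)
        rw [d1, dist_eq_one_iff_adj.2 hq.symm] at this
        exact this
      have h3 : 3 ≤ Γ.dist q u := by
        refine hconn.three_le_dist ?_ ?_ ?_
        · rintro rfl
          exact hau hq
        · intro hqu
          exact hqv (eq_of_square_of_six_le_egirth h hq hqu hu.symm ha hua.symm)
        · intro c hc hcu
          exact not_pentagon_of_six_le_egirth h hq hc hcu hu.symm ha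
      lia

end SimpleGraph

/-! ### Weak convexity -/

section WeakConvexity

open RAAG

variable {V : Type u} {Γ : SimpleGraph V}

theorem RAAG.LeftReduced.not_inStar_of_append {u : V} {e : List (V × ℤ)} {s : V × ℤ}
    (h : LeftReduced Γ u (e ++ [s])) : ¬ InStar Γ u s.1 := by
  induction e with
  | nil => exact fun hs => h.1 ⟨hs, by simp⟩
  | cons a e ih => exact ih h.2

/-- Write z as a conjugate of u by e within the star of v. The leftmost syllable s of e is not in
the star of u, and a geodesic from x to z crosses its wall at a vertex of type q in the star of s.
After projecting to Γ, the girth bound at q shows that v is closer than u. -/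
theorem dist_add_one_le_of_commute (hconn : Γ.Connected) (hg : 6 ≤ Γ.egirth) {v : V} {g : RAAG Γ}
    {x z : ExtVertex Γ} (hx : x ∈ (translateGraph Γ g).verts)
    (hz : z ∉ (translateGraph Γ g).verts) (hc : Commute z.1 (conjVertex Γ v g).1) :
    (extensionGraph Γ).dist x (conjVertex Γ v g) + 1 ≤ (extensionGraph Γ).dist x z := by
  obtain ⟨a, rfl⟩ := hx
  obtain ⟨u, h, rfl⟩ := z.exists_eq
  obtain ⟨hvu, e, he, hl, hev, hze⟩ := exists_conjVertex_of_commute hc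
  rw [hze] at hz ⊢
  rcases List.eq_nil_or_concat e with rfl | ⟨e, s, rfl⟩
  · exact absurd ⟨u, by simp⟩ hz
  simp only [List.concat_eq_append] at *
  have hus : ¬ InStar Γ u s.1 := hl.not_inStar_of_append
  have hvs : InStar Γ v s.1 := hev s (by simp)
  have hvu' : Γ.Adj v u := hvu.resolve_left (by rintro rfl; exact hus hvs)
  have hvs' : Γ.Adj v s.1 := hvs.resolve_left (fun h => hus (h ▸ hvu.symm))
  obtain ⟨p, hp⟩ := (extensionGraph_connected hconn).exists_walk_length_eq_dist
    (conjVertex Γ a g) (conjVertex Γ u (syllableProd Γ (e ++ [s]) * g))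
  obtain ⟨y, hy, hyc⟩ := he.exists_mem_support_commute p
  obtain ⟨q, k, rfl⟩ := y.exists_eq
  obtain ⟨hq, -⟩ := exists_conjVertex_of_commute hyc
  have h1 := p.dist_add_dist_le_length hy
  have h2 := dist_vertexType_le hconn (conjVertex Γ a g) (conjVertex Γ q k)
  have h3 := dist_vertexType_le hconn (conjVertex Γ q k)
    (conjVertex Γ u (syllableProd Γ (e ++ [s]) * g))
  simp only [vertexType_conjVertex] at h2 h3
  have h4 := SimpleGraph.dist_add_one_le_of_six_le_egirth hconn hg hvu' hvs'
    (fun h => hus (Or.inl h.symm)) hq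
  have h5 := hconn.dist_triangle (u := a) (v := q) (w := v)
  rw [dist_conjVertex hconn]
  lia

theorem exists_geodesic_of_reducedWord (hconn : Γ.Connected) (hg : 6 ≤ Γ.egirth)
    (t : List (V × ℤ)) (ht : ReducedWord Γ t) (g : RAAG Γ) (H : (extensionGraph Γ).Subgraph)
    (hH : ∀ l l', t = l ++ l' → translateGraph Γ (syllableProd Γ l * g) ≤ H)
    {x y : ExtVertex Γ} (hx : x ∈ (translateGraph Γ g).verts)
    (hy : y ∈ (translateGraph Γ (syllableProd Γ t * g)).verts) :
    ∃ p : (extensionGraph Γ).Walk x y, IsGeodesicWalk p ∧ p.toSubgraph ≤ H := by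
  induction t generalizing g x with
  | nil =>
    obtain ⟨p, h1, h2⟩ := exists_geodesic_in_translateGraph hconn hx (by simpa using hy)
    exact ⟨p, h1, h2.trans (by simpa using hH [] [] rfl)⟩
  | cons s t ih =>
    have hc := extensionGraph_connected hconn
    have hfix : ∀ u, InStar Γ s.1 u →
        conjVertex Γ u (gen Γ s.1 ^ s.2 * g) = conjVertex Γ u g :=
      fun u hu => conjVertex_mul_of_mem (zpow_mem_starGroup hu.symm _) g
    obtain ⟨z, hz, hz', hd⟩ : ∃ z, z ∈ (translateGraph Γ g).verts ∧
        z ∈ (translateGraph Γ (gen Γ s.1 ^ s.2 * g)).verts ∧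
        (extensionGraph Γ).dist x z + (extensionGraph Γ).dist z y
          ≤ (extensionGraph Γ).dist x y := by
      obtain ⟨p, hp⟩ := hc.exists_walk_length_eq_dist x y
      obtain ⟨z, hz, hzc⟩ : ∃ z ∈ p.support, Commute z.1 (conjVertex Γ s.1 g).1 := by
        obtain ⟨u, rfl⟩ := hx
        obtain ⟨w, rfl⟩ := hy
        simpa using ht.exists_mem_support_commute (l := []) p
      have h1 := p.dist_add_dist_le_length hz
      -- A crossing inside Γ^g has its type in the star of s, so it also lies in the next translate.
      by_cases hzg : z ∈ (translateGraph Γ g).verts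
      · refine ⟨z, hzg, ?_, by lia⟩
        obtain ⟨u, rfl⟩ := hzg
        exact ⟨u, hfix u (commute_conjVertex_iff.1 hzc)⟩
      -- Otherwise pass through the wall vertex: it is nearer to x by at least one and at most one
      -- step from z, so nothing is lost.
      · refine ⟨conjVertex Γ s.1 g, ⟨s.1, rfl⟩, ⟨s.1, hfix _ (InStar.refl _)⟩, ?_⟩
        have h2 := dist_add_one_le_of_commute hconn hg hx hzg hzc
        have h3 := dist_le_one_of_commute hzc.symm
        have h4 := hc.dist_triangle (u := conjVertex Γ s.1 g) (v := z) (w := y)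
        lia
    obtain ⟨p, hp, hpH⟩ := exists_geodesic_in_translateGraph hconn hx hz
    obtain ⟨q, hq, hqH⟩ := ih ht.2.2 (gen Γ s.1 ^ s.2 * g) (fun l l' hl => by
      have := hH (s :: l) l' (by rw [hl, List.cons_append])
      rwa [syllableProd_cons, mul_assoc] at this) hz'
      (by rwa [syllableProd_cons, mul_assoc] at hy)
    refine ⟨p.append q, le_antisymm ?_ (SimpleGraph.dist_le _), ?_⟩
    · rw [SimpleGraph.Walk.length_append, hp, hq]
      exact hd
    · rw [SimpleGraph.Walk.toSubgraph_append]
      exact sup_le (hpH.trans (by simpa using hH [] (s :: t) rfl)) hqH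

end WeakConvexity

/-! ### Ends of graphs covered by a line of connected finite subgraphs -/

namespace SimpleGraph

variable {W : Type u} {G : SimpleGraph W}

/-- The vertices of the component chosen by the section `e` outside `K`. -/
def endSupp (G : SimpleGraph W) (e : (j : (Finset W)ᵒᵖ) → G.componentComplFunctor.obj j)
    (K : Finset W) : Set W :=
  ComponentCompl.supp (G := G) (K := (K : Set W)) (e (Opposite.op K))

theorem eq_of_mem_endSupp {e e' : (j : (Finset W)ᵒᵖ) → G.componentComplFunctor.obj j}
    {K : Finset W} {x : W} (h : x ∈ endSupp G e K) (h' : x ∈ endSupp G e' K) :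
    e (Opposite.op K) = e' (Opposite.op K) := by
  obtain ⟨_, h1⟩ := h
  obtain ⟨_, h2⟩ := h'
  exact h1.symm.trans h2

theorem endSupp_subset {e : (j : (Finset W)ᵒᵖ) → G.componentComplFunctor.obj j}
    (he : e ∈ G.end) {K L : Finset W} (h : K ⊆ L) : endSupp G e L ⊆ endSupp G e K := by
  have h1 : ComponentCompl.hom (G := G) (Finset.coe_subset.2 h) (e (Opposite.op L))
      = e (Opposite.op K) := he (CategoryTheory.opHomOfLE h)
  intro x hx
  have := ComponentCompl.subset_hom (G := G) (e (Opposite.op L)) (Finset.coe_subset.2 h) hx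
  rwa [h1] at this

theorem endSupp_nonempty (e : (j : (Finset W)ᵒᵖ) → G.componentComplFunctor.obj j)
    (K : Finset W) : (endSupp G e K).Nonempty :=
  ComponentCompl.nonempty (G := G) (K := (K : Set W)) (e (Opposite.op K))

theorem notMem_of_mem_endSupp {e : (j : (Finset W)ᵒᵖ) → G.componentComplFunctor.obj j}
    {K : Finset W} {x : W} (h : x ∈ endSupp G e K) : x ∉ K := by
  obtain ⟨h, -⟩ := h
  exact h

theorem componentComplMk_eq_of_reachable_induce {K A : Set W} (h : Disjoint A K)
    (hA : (G.induce A).Preconnected) {x y : W} (hx : x ∈ A) (hy : y ∈ A) (hxK : x ∉ K)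
    (hyK : y ∉ K) : G.componentComplMk hxK = G.componentComplMk hyK := by
  have hsub : A ⊆ Kᶜ := h.subset_compl_right
  exact ConnectedComponent.eq.2
    ((hA ⟨x, hx⟩ ⟨y, hy⟩).map (induceHom Hom.id (Set.mapsTo_iff_subset_preimage.2 hsub)))

/-- A sequence of overlapping connected sets that leaves every finite set defines an end. -/
theorem exists_end_of_ray (A : ℕ → Set W) (hA : ∀ n, (G.induce (A n)).Preconnected)
    (hmeet : ∀ n, (A n ∩ A (n + 1)).Nonempty) (hfin : ∀ x, {n | x ∈ A n}.Finite) :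
    ∃ e ∈ G.end, ∀ K : Finset W, ∀ᶠ n in Filter.atTop, A n ⊆ endSupp G e K := by
  have hB : ∀ K : Finset W, ∃ B : ℕ, ∀ n ≥ B, Disjoint (A n) (K : Set W) := by
    intro K
    have h1 : (⋃ x ∈ K, {n | x ∈ A n}).Finite := K.finite_toSet.biUnion fun x _ => hfin x
    obtain ⟨b, hb⟩ := h1.bddAbove
    refine ⟨b + 1, fun n hn => Set.disjoint_left.2 fun x hx hxK => ?_⟩
    have := hb (Set.mem_biUnion (Finset.mem_coe.1 hxK) hx)
    lia
  choose B hB using hB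
  have hne : ∀ n, (A n).Nonempty := fun n => (hmeet n).mono Set.inter_subset_left
  choose a ha using hne
  have hout : ∀ (K : Finset W) n, B K ≤ n → ∀ x ∈ A n, x ∉ (K : Set W) :=
    fun K n hn x hx => Set.disjoint_left.1 (hB K n hn) hx
  have key : ∀ (K : Finset W) n (hn : B K ≤ n) x (hx : x ∈ A n),
      G.componentComplMk (hout K n hn x hx) =
        G.componentComplMk (hout K (B K) le_rfl (a (B K)) (ha _)) := by
    intro K n hn
    induction n, hn using Nat.le_induction with
    | base =>
      intro x hx
      exact componentComplMk_eq_of_reachable_induce (hB K _ le_rfl) (hA _) hx (ha _) _ _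
    | succ n hn ih =>
      intro x hx
      obtain ⟨y, hy, hy'⟩ := hmeet n
      rw [← ih y hy]
      exact componentComplMk_eq_of_reachable_induce (hB K (n + 1) (by lia)) (hA _) hx hy' _ _
  let e : (j : (Finset W)ᵒᵖ) → G.componentComplFunctor.obj j :=
    fun j => G.componentComplMk (hout j.unop (B j.unop) le_rfl (a (B j.unop)) (ha _))
  have hmem : ∀ (K : Finset W) n, B K ≤ n → A n ⊆ endSupp G e K :=
    fun K n hn x hx => ⟨hout K n hn x hx, key K n hn x hx⟩
  refine ⟨e, ?_, fun K => Filter.eventually_atTop.2 ⟨B K, hmem K⟩⟩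
  intro i j f
  refine (ComponentCompl.hom_eq_iff_not_disjoint (G := G) (e i)
    (CategoryTheory.le_of_op_hom f) (e j)).2 (Set.not_disjoint_iff.2
      ⟨a (max (B i.unop) (B j.unop)), ?_, ?_⟩)
  · exact hmem i.unop _ (le_max_left _ _) (ha _)
  · exact hmem j.unop _ (le_max_right _ _) (ha _)

theorem mem_iff_of_mem_endSupp {e : (j : (Finset W)ᵒᵖ) → G.componentComplFunctor.obj j}
    {T : Finset W} {P : Set W} (hP : ∀ x y, x ∉ T → y ∉ T → G.Adj x y → x ∈ P → y ∈ P) {x y : W}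
    (hx : x ∈ endSupp G e T) (hy : y ∈ endSupp G e T) (h : x ∈ P) : y ∈ P := by
  obtain ⟨hxT, h1⟩ := hx
  obtain ⟨hyT, h2⟩ := hy
  obtain ⟨p⟩ := ConnectedComponent.eq.1 (h1.trans h2.symm)
  suffices H : ∀ (a b : ((T : Set W)ᶜ : Set W)) (p : (G.induce (T : Set W)ᶜ).Walk a b),
      a.1 ∈ P → b.1 ∈ P from H _ _ p h
  intro a b p
  induction p with
  | nil => exact id
  | @cons a c _ hadj _ ih => exact fun ha => ih (hP a c a.2 c.2 hadj ha)

/-- A graph covered by a line of overlapping connected finite sets has two ends, if a finite set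
`T` separates the positive from the negative part; and then `T` separates the ends. -/
theorem ends_of_line (A : ℤ → Set W) (hA : ∀ m, (G.induce (A m)).Preconnected)
    (hAfin : ∀ m, (A m).Finite) (hmeet : ∀ m, (A m ∩ A (m + 1)).Nonempty)
    (hcover : ∀ x, ∃ m, x ∈ A m) (hfin : ∀ x, {m | x ∈ A m}.Finite) (T : Finset W) (P : Set W)
    (hP : ∀ x y, x ∉ T → y ∉ T → G.Adj x y → x ∈ P → y ∈ P)
    (hpos : ∀ᶠ n : ℕ in Filter.atTop, A n ⊆ P)
    (hneg : ∀ᶠ n : ℕ in Filter.atTop, Disjoint (A (-n)) P) :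
    (G.end).Nontrivial ∧ ∀ e ∈ G.end, ∀ e' ∈ G.end, e ≠ e' →
      e (Opposite.op T) ≠ e' (Opposite.op T) := by
  classical
  obtain ⟨p, hp, hpK⟩ := exists_end_of_ray (G := G) (fun n : ℕ => A n) (fun n => hA n)
    (fun n => by simpa using hmeet n)
    (fun x => (hfin x).preimage Nat.cast_injective.injOn)
  obtain ⟨q, hq, hqK⟩ := exists_end_of_ray (G := G) (fun n : ℕ => A (-n)) (fun n => hA _)
    (fun n => by
      have := hmeet (-(n : ℤ) - 1)
      rw [sub_add_cancel, Set.inter_comm] at this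
      convert this using 3
      push_cast
      ring)
    (fun x => (hfin x).preimage (f := fun n : ℕ => -(n : ℤ))
      (fun a _ b _ hab => by simpa using hab))
  have hne : ∀ m, (A m).Nonempty := fun m => (hmeet m).mono Set.inter_subset_left
  have hpq : p (Opposite.op T) ≠ q (Opposite.op T) := by
    intro heq
    obtain ⟨n, ⟨⟨h1, h2⟩, h3⟩, h4⟩ := (((hpK T).and (hqK T)).and hpos |>.and hneg).exists
    obtain ⟨x, hx⟩ := hne n
    obtain ⟨y, hy⟩ := hne (-n)
    have hx' : x ∈ endSupp G q T := by
      have := h1 hx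
      rwa [endSupp, heq] at this
    exact Set.disjoint_left.1 h4 hy (mem_iff_of_mem_endSupp hP hx' (h2 hy) (h3 hx))
  -- Enlarge K by the finitely many sets with |m| ≤ B. The component of e still has a vertex, which
  -- lies in a set far out on one of the two rays.
  have hdich : ∀ e ∈ G.end, ∀ K : Finset W,
      e (Opposite.op K) = p (Opposite.op K) ∨ e (Opposite.op K) = q (Opposite.op K) := by
    intro e he K
    obtain ⟨B, hB⟩ := Filter.eventually_atTop.1 ((hpK K).and (hqK K))
    have hF : (⋃ m ∈ Finset.Icc (-(B : ℤ)) B, A m).Finite :=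
      (Finset.Icc (-(B : ℤ)) B).finite_toSet.biUnion fun m _ => hAfin m
    obtain ⟨x, hx⟩ := endSupp_nonempty e (K ∪ hF.toFinset)
    have hxK := endSupp_subset he Finset.subset_union_left hx
    have hxF := fun h => notMem_of_mem_endSupp hx (Finset.mem_union_right _ (hF.mem_toFinset.2 h))
    obtain ⟨m, hm⟩ := hcover x
    have hmB : m ∉ Finset.Icc (-(B : ℤ)) B := fun h => hxF (Set.mem_biUnion h hm)
    rw [Finset.mem_Icc, not_and_or, not_le, not_le] at hmB
    rcases hmB with hmB | hmB
    · obtain ⟨n, rfl⟩ : ∃ n : ℕ, m = -n := ⟨m.natAbs, by lia⟩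
      exact Or.inr (eq_of_mem_endSupp hxK ((hB n (by lia)).2 hm))
    · obtain ⟨n, rfl⟩ : ∃ n : ℕ, m = n := ⟨m.natAbs, by lia⟩
      exact Or.inl (eq_of_mem_endSupp hxK ((hB n (by lia)).1 hm))
  -- Agreement with r' at K ∪ T would pass down to T, where e agrees with r and not with r'.
  have huniq : ∀ e ∈ G.end, ∀ r ∈ G.end, ∀ r' ∈ G.end,
      (∀ K : Finset W, e (Opposite.op K) = r (Opposite.op K) ∨
        e (Opposite.op K) = r' (Opposite.op K)) →
      r (Opposite.op T) ≠ r' (Opposite.op T) → e (Opposite.op T) = r (Opposite.op T) →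
      e = r := by
    intro e he r hr r' hr' hd hrr heT
    funext j
    obtain ⟨K⟩ := j
    obtain ⟨x, hx⟩ := endSupp_nonempty e (K ∪ T)
    rcases hd (K ∪ T) with h | h
    · have hx' : x ∈ endSupp G r (K ∪ T) := by rwa [endSupp, ← h]
      exact eq_of_mem_endSupp (endSupp_subset he Finset.subset_union_left hx)
        (endSupp_subset hr Finset.subset_union_left hx')
    · have hx' : x ∈ endSupp G r' (K ∪ T) := by rwa [endSupp, ← h]
      exact absurd (heT.symm.trans (eq_of_mem_endSupp
        (endSupp_subset he Finset.subset_union_right hx)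
        (endSupp_subset hr' Finset.subset_union_right hx'))) hrr
  refine ⟨⟨p, hp, q, hq, fun h => hpq (by rw [h])⟩, fun e he e' he' hne' heq => hne' ?_⟩
  rcases hdich e he T with h | h
  · rw [huniq e he p hp q hq (hdich e he) hpq h,
      huniq e' he' p hp q hq (hdich e' he') hpq (heq.symm.trans h)]
  · rw [huniq e he q hq p hp (fun K => (hdich e he K).symm) hpq.symm h,
      huniq e' he' q hq p hp (fun K => (hdich e' he' K).symm) hpq.symm (heq.symm.trans h)]

end SimpleGraph

/-! ### Axial subgraphs -/

section AxialSequence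

open RAAG

variable {V : Type u} {Γ : SimpleGraph V}

/-- The word formed by the terms of the sequence with indices `m, …, m + n - 1`. -/
def window (σ : ℤ → V × ℤ) (m : ℤ) : ℕ → List (V × ℤ)
  | 0 => []
  | n + 1 => σ m :: window σ (m + 1) n

/-- A bi-infinite sequence of group elements, each obtained from the preceding one by
multiplication with a syllable, such that all subwords are reduced and that is periodic with
period `N` up to right multiplication by `g`, where no power of `g` fixes a vertex of the
extension graph. -/
structure IsAxialSequence (Γ : SimpleGraph V) (σ : ℤ → V × ℤ) (η : ℤ → RAAG Γ) (g : RAAG Γ)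
    (N : ℕ) : Prop where
  pos : 0 < N
  succ : ∀ m, η (m + 1) = gen Γ (σ m).1 ^ (σ m).2 * η m
  period : ∀ m, η (m + N) = η m * g
  reduced : ∀ m n, ReducedWord Γ (window σ m n)
  not_fixed : ∀ (u : V) (h : RAAG Γ) (k : ℤ), conjVertex Γ u (h * g ^ k) = conjVertex Γ u h → k = 0

theorem length_window (σ : ℤ → V × ℤ) (m : ℤ) (n : ℕ) : (window σ m n).length = n := by
  induction n generalizing m with
  | zero => rfl
  | succ n ih => simp [window, ih]

theorem window_add (σ : ℤ → V × ℤ) (m : ℤ) (a b : ℕ) :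
    window σ m (a + b) = window σ m a ++ window σ (m + a) b := by
  induction a generalizing m with
  | zero => simp [window]
  | succ a ih =>
    have e : a + 1 + b = (a + b) + 1 := by lia
    have e' : m + 1 + (a : ℤ) = m + ((a + 1 : ℕ) : ℤ) := by push_cast; ring
    rw [e, window, window, ih, List.cons_append, e']

theorem syllableProd_window_mul {σ : ℤ → V × ℤ} {η : ℤ → RAAG Γ}
    (h : ∀ m, η (m + 1) = gen Γ (σ m).1 ^ (σ m).2 * η m) (m : ℤ) (n : ℕ) :
    syllableProd Γ (window σ m n) * η m = η (m + n) := by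
  induction n generalizing m with
  | zero => simp [window]
  | succ n ih =>
    rw [window, syllableProd_cons, mul_assoc, ← h, ih]
    congr 1
    push_cast
    ring

/-- The union of the translates of `Γ` along a sequence of group elements. -/
def translateUnion (Γ : SimpleGraph V) (η : ℤ → RAAG Γ) : (extensionGraph Γ).Subgraph :=
  ⨆ m : ℤ, translateGraph Γ (η m)

theorem mem_translateUnion {η : ℤ → RAAG Γ} {x : ExtVertex Γ} :
    x ∈ (translateUnion Γ η).verts ↔ ∃ m, x ∈ (translateGraph Γ (η m)).verts := by
  simp [translateUnion]

theorem translateUnion_adj {η : ℤ → RAAG Γ} {x y : ExtVertex Γ} :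
    (translateUnion Γ η).Adj x y ↔ ∃ m, (translateGraph Γ (η m)).Adj x y := by
  simp [translateUnion]

theorem translateGraph_adj {g : RAAG Γ} {x y : ExtVertex Γ} :
    (translateGraph Γ g).Adj x y ↔ x ∈ (translateGraph Γ g).verts ∧
      y ∈ (translateGraph Γ g).verts ∧ (extensionGraph Γ).Adj x y := by
  simp [translateGraph]

theorem op_smul_conjVertex (u : V) (g h : RAAG Γ) :
    MulOpposite.op g • conjVertex Γ u h = conjVertex Γ u (h * g) :=
  Subtype.ext (by
    change g⁻¹ * (h⁻¹ * gen Γ u * h) * g = (h * g)⁻¹ * gen Γ u * (h * g)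
    group)

theorem op_zpow_smul_conjVertex (u : V) (g h : RAAG Γ) (k : ℤ) :
    MulOpposite.op g ^ k • conjVertex Γ u h = conjVertex Γ u (h * g ^ k) := by
  rw [← MulOpposite.op_zpow, op_smul_conjVertex]

theorem actsSimplicially_extensionGraph (Γ : SimpleGraph V) :
    ActsSimplicially (RAAG Γ)ᵐᵒᵖ (extensionGraph Γ) := by
  intro g x y
  refine and_congr (MulAction.injective g).ne_iff ?_
  exact commute_conj_iff (g := g.unop)

theorem op_smul_mem_translateGraph {x : ExtVertex Γ} {g h : RAAG Γ} :
    MulOpposite.op g • x ∈ (translateGraph Γ (h * g)).verts ↔ x ∈ (translateGraph Γ h).verts := by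
  constructor
  · rintro ⟨u, hu⟩
    refine ⟨u, MulAction.injective (MulOpposite.op g) ?_⟩
    exact (op_smul_conjVertex u g h).trans hu
  · rintro ⟨u, rfl⟩
    exact ⟨u, (op_smul_conjVertex u g h).symm⟩

theorem translateGraph_verts_finite [Finite V] (g : RAAG Γ) :
    (translateGraph Γ g).verts.Finite :=
  Set.finite_range _

namespace IsAxialSequence

variable {σ : ℤ → V × ℤ} {η : ℤ → RAAG Γ} {g : RAAG Γ} {N : ℕ}

theorem syllableProd_window (h : IsAxialSequence Γ σ η g N) (m : ℤ) (n : ℕ) :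
    syllableProd Γ (window σ m n) * η m = η (m + n) :=
  syllableProd_window_mul h.succ m n

theorem period_zpow (h : IsAxialSequence Γ σ η g N) (m k : ℤ) :
    η (m + N * k) = η m * g ^ k := by
  induction k using Int.induction_on with
  | zero => simp
  | succ k ih =>
    have e : m + N * ((k : ℤ) + 1) = m + N * k + N := by ring
    rw [e, h.period, ih, zpow_add_one, mul_assoc]
  | pred k ih =>
    have e : m + N * (-(k : ℤ)) = m + N * (-(k : ℤ) - 1) + N := by ring
    rw [e, h.period] at ih
    rw [zpow_sub_one, ← mul_assoc, ← ih, mul_inv_cancel_right]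

/-- Two indices congruent modulo N whose translates both contain x would give a power of g fixing x,
so the residue is injective on this set. -/
theorem finite_setOf_mem (h : IsAxialSequence Γ σ η g N) (x : ExtVertex Γ) :
    {m | x ∈ (translateGraph Γ (η m)).verts}.Finite := by
  have hN : (0 : ℤ) < N := by exact_mod_cast h.pos
  refine Set.Finite.of_injOn (f := fun m => m % (N : ℤ)) (t := Set.Ico 0 (N : ℤ)) ?_ ?_
    (Set.finite_Ico _ _)
  · exact fun m _ => ⟨Int.emod_nonneg _ hN.ne', Int.emod_lt_of_pos _ hN⟩
  · rintro m ⟨u, hu⟩ m' ⟨u', hu'⟩ (hmm : m % (N : ℤ) = m' % (N : ℤ))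
    obtain ⟨k, hk⟩ := (Int.ModEq.dvd hmm : (N : ℤ) ∣ m' - m)
    obtain rfl : m' = m + N * k := by lia
    have e := hu'.trans hu.symm
    obtain rfl := eq_of_conjVertex_eq e
    rw [h.period_zpow] at e
    simp [h.not_fixed _ _ _ e]

theorem isWeaklyConvex (h : IsAxialSequence Γ σ η g N) (hconn : Γ.Connected)
    (hg : 6 ≤ Γ.egirth) : IsWeaklyConvex (translateUnion Γ η) := by
  have key : ∀ (m : ℤ) (n : ℕ) (x y : ExtVertex Γ), x ∈ (translateGraph Γ (η m)).verts →
      y ∈ (translateGraph Γ (η (m + n))).verts → ∃ p : (extensionGraph Γ).Walk x y,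
        IsGeodesicWalk p ∧ p.toSubgraph ≤ translateUnion Γ η := by
    intro m n x y hx hy
    refine exists_geodesic_of_reducedWord hconn hg _ (h.reduced m n) (η m) _ ?_ hx
      (by rwa [h.syllableProd_window])
    intro l l' hl
    have hlen := congrArg List.length hl
    rw [length_window, List.length_append] at hlen
    rw [hlen, window_add] at hl
    rw [← (List.append_inj hl (length_window _ _ _)).1, h.syllableProd_window]
    exact le_iSup (fun m => translateGraph Γ (η m)) _
  intro x hx y hy
  obtain ⟨m, hx⟩ := mem_translateUnion.1 hx
  obtain ⟨m', hy⟩ := mem_translateUnion.1 hy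
  rcases le_total m m' with hm | hm
  · obtain ⟨n, rfl⟩ := Int.le.dest hm
    exact key m n x y hx hy
  · obtain ⟨n, rfl⟩ := Int.le.dest hm
    obtain ⟨p, hp, hpH⟩ := key m' n y x hy hx
    refine ⟨p.reverse, ?_, by rwa [SimpleGraph.Walk.toSubgraph_reverse]⟩
    rw [IsGeodesicWalk, SimpleGraph.Walk.length_reverse, hp, SimpleGraph.dist_comm]

theorem isAxialSubgraph [Finite V] (h : IsAxialSequence Γ σ η g N) (hconn : Γ.Connected)
    (hg : 6 ≤ Γ.egirth) :
    IsAxialSubgraph (extensionGraph Γ) (MulOpposite.op g) (translateUnion Γ η) := by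
  have hN : (0 : ℤ) < N := by exact_mod_cast h.pos
  have hshift : ∀ p : RAAG Γ → Prop, (∃ m, p (η m)) ↔ ∃ m, p (η m * g) := by
    intro p
    constructor
    · rintro ⟨m, hm⟩
      exact ⟨m - N, by rwa [← h.period, sub_add_cancel]⟩
    · rintro ⟨m, hm⟩
      exact ⟨m + N, by rwa [h.period]⟩
  have hsimp := actsSimplicially_extensionGraph Γ
  refine ⟨?_, h.isWeaklyConvex hconn hg, ?_, ?_, ?_, ?_⟩
  · obtain ⟨u⟩ := hconn.nonempty
    exact ⟨conjVertex Γ u (η 0), mem_translateUnion.2 ⟨0, u, rfl⟩⟩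
  · intro x _
    refine ((h.finite_setOf_mem x).biUnion fun m _ => translateGraph_verts_finite (η m)).subset ?_
    intro y hy
    obtain ⟨m, hm⟩ := translateUnion_adj.1 hy
    obtain ⟨h1, h2, -⟩ := translateGraph_adj.1 hm
    exact Set.mem_biUnion (show m ∈ {m | x ∈ (translateGraph Γ (η m)).verts} from h1) h2
  · intro x
    rw [mem_translateUnion, mem_translateUnion,
      hshift fun r => MulOpposite.op g • x ∈ (translateGraph Γ r).verts]
    exact exists_congr fun m => op_smul_mem_translateGraph
  · intro x y
    rw [translateUnion_adj, translateUnion_adj,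
      hshift fun r => (translateGraph Γ r).Adj (MulOpposite.op g • x) (MulOpposite.op g • y)]
    refine exists_congr fun m => ?_
    rw [translateGraph_adj, translateGraph_adj, op_smul_mem_translateGraph,
      op_smul_mem_translateGraph, hsimp]
  · refine ⟨⋃ m ∈ Set.Ico (0 : ℤ) N, (translateGraph Γ (η m)).verts,
      (Set.finite_Ico _ _).biUnion fun m _ => translateGraph_verts_finite _, ?_, ?_⟩
    · exact Set.iUnion₂_subset fun m _ x hx => mem_translateUnion.2 ⟨m, hx⟩
    · intro x hx
      obtain ⟨m, u, rfl⟩ := mem_translateUnion.1 hx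
      refine ⟨m / N, conjVertex Γ u (η (m % N)), Set.mem_biUnion (x := m % (N : ℤ))
        ⟨Int.emod_nonneg _ hN.ne', Int.emod_lt_of_pos _ hN⟩ ⟨u, rfl⟩, ?_⟩
      rw [op_zpow_smul_conjVertex, ← h.period_zpow, Int.emod_add_mul_ediv]

/-! ### Separating the ends of an axial subgraph -/

theorem side_of_pos (h : IsAxialSequence Γ σ η g N) {m : ℤ} (hm : 0 < m) :
    side Γ (σ 0).1 (η m * (η 0)⁻¹) = (σ 0).2 := by
  obtain ⟨n, rfl⟩ : ∃ n : ℕ, m = (n + 1 : ℕ) := ⟨m.natAbs - 1, by lia⟩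
  have e := h.syllableProd_window 0 (n + 1)
  rw [zero_add] at e
  rw [← e, mul_inv_cancel_right]
  exact (h.reduced 0 (n + 1)).side_cons

theorem inv_syllableProd_window (h : IsAxialSequence Γ σ η g N) (m : ℤ) (n : ℕ) :
    η m = (syllableProd Γ (window σ m n))⁻¹ * η (m + n) := by
  rw [← h.syllableProd_window, inv_mul_cancel_left]

theorem side_of_nonpos (h : IsAxialSequence Γ σ η g N) {m : ℤ} (hm : m ≤ 0) :
    side Γ (σ 0).1 (η m * (η 0)⁻¹) = 0 := by
  obtain ⟨n, rfl⟩ : ∃ n : ℕ, m = -n := ⟨m.natAbs, by lia⟩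
  rw [h.inv_syllableProd_window (-n) n, neg_add_cancel, mul_inv_cancel_right]
  have := h.reduced (-n) (n + 1)
  rw [window_add, neg_add_cancel] at this
  exact this.side_inv_eq_zero

end IsAxialSequence

/-- Represent the vertex as u^{eh} with e in the star of v. The wall of s separates the two
representatives s::t and e, so u^e must commute with s; hence every syllable of e lies in the stars
of both v and s. A last syllable of e would then complete a square, so e is empty. -/
theorem adj_and_eq_of_commute (hg : 6 ≤ Γ.egirth) {s : V × ℤ} {t : List (V × ℤ)}
    (ht : ReducedWord Γ (s :: t)) {u v : V} (hs : ¬ InStar Γ v s.1) {h : RAAG Γ}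
    (hc : Commute (conjVertex Γ u (syllableProd Γ (s :: t) * h)).1 (conjVertex Γ v h).1) :
    Γ.Adj v u ∧ conjVertex Γ u (syllableProd Γ (s :: t) * h) = conjVertex Γ u h := by
  obtain ⟨hvu, e, he, hl, hev, hze⟩ := exists_conjVertex_of_commute hc
  rw [hze]
  have hd : syllableProd Γ (s :: t) * (syllableProd Γ e)⁻¹ ∈ starGroup Γ u := by
    simpa using conjVertex_eq_iff.1 hze
  have hE := side_eq_zero_of_mem_starGroup (syllableProd_mem_starGroup hev) hs
  obtain ⟨hus, c, hcu, hcs⟩ : InStar Γ u s.1 ∧ ∃ c ∈ starGroup Γ u,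
      c * syllableProd Γ e ∈ starGroup Γ s.1 := by
    by_contra! hcon
    have h1 := side_mul_of_forall_not hd hcon
    rw [inv_mul_cancel_right, ht.side_cons, hE] at h1
    exact ht.1 h1
  have hvu' : Γ.Adj v u := hvu.resolve_left (by rintro rfl; exact hs hus)
  have hus' : Γ.Adj u s.1 := hus.resolve_left (fun h => hs (h ▸ hvu))
  refine ⟨hvu', ?_⟩
  have h2 : Commute (conjVertex Γ u (syllableProd Γ e)).1 (conjVertex Γ s.1 1).1 := by
    rw [← conjVertex_mul_of_mem hcu, ← conjVertex_mul_of_mem hcs 1, mul_one]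
    exact commute_conjVertex_iff.2 hus.symm
  have h3 := (inStar_of_commute_conj he hl (w := s.1) (by simpa [conjVertex] using h2)).2
  rcases List.eq_nil_or_concat e with rfl | ⟨e, r, rfl⟩
  · simp
  exfalso
  rw [List.concat_eq_append] at hl hev h3
  have hur := hl.not_inStar_of_append
  have hvr : Γ.Adj v r.1 := (hev r (by simp)).resolve_left fun h => hur (h ▸ hvu.symm)
  have hsr : Γ.Adj s.1 r.1 := (h3 r (by simp)).resolve_left fun h => hur (h ▸ hus)
  -- The vertices u and r are common neighbours of the distinct vertices v and s.
  exact hur (Or.inl (SimpleGraph.eq_of_square_of_six_le_egirth hg hvu' hus' hsr hvr.symm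
    (fun h => hs (Or.inl h.symm))).symm)

/-- The vertices that lie outside the star of `v ^ k` on the side `j` of its wall. -/
def wallSide (Γ : SimpleGraph V) (v : V) (k : RAAG Γ) (j : ℤ) : Set (ExtVertex Γ) :=
  {x | ¬ Commute x.1 (conjVertex Γ v k).1 ∧
    ∀ u h, x = conjVertex Γ u h → side Γ v (h * k⁻¹) = j}

theorem conjVertex_mem_wallSide {u v : V} {h k : RAAG Γ} {j : ℤ}
    (hc : ¬ Commute (conjVertex Γ u h).1 (conjVertex Γ v k).1) (hj : side Γ v (h * k⁻¹) = j) :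
    conjVertex Γ u h ∈ wallSide Γ v k j :=
  ⟨hc, fun _ _ e => (side_eq_of_conjVertex_eq hc e).symm.trans hj⟩

/-- The wall vertex v^k itself may be missing from S: its neighbours all commute with it, so none of
them is in `wallSide`. This is why the link suffices instead of the closed star. -/
theorem mem_wallSide_of_adj {η : ℤ → RAAG Γ} {v : V} {k : RAAG Γ} {j : ℤ} {S : Set (ExtVertex Γ)}
    (hS : ∀ m, side Γ v (η m * k⁻¹) = j → ∀ z ∈ (translateGraph Γ (η m)).verts,
      Commute z.1 (conjVertex Γ v k).1 → z ∈ S ∨ z = conjVertex Γ v k) {x y : ExtVertex Γ}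
    (hy : y ∉ S) (hadj : (translateUnion Γ η).Adj x y) (hx : x ∈ wallSide Γ v k j) :
    y ∈ wallSide Γ v k j := by
  obtain ⟨m, hm⟩ := translateUnion_adj.1 hadj
  obtain ⟨⟨a, rfl⟩, ⟨b, rfl⟩, hab⟩ := translateGraph_adj.1 hm
  have hj := hx.2 _ _ rfl
  refine conjVertex_mem_wallSide (fun hc => ?_) hj
  rcases hS m hj _ ⟨b, rfl⟩ hc with h | h
  · exact hy h
  · apply hx.1
    rw [← h]
    exact hab.2

namespace IsAxialSequence

variable {σ : ℤ → V × ℤ} {η : ℤ → RAAG Γ} {g : RAAG Γ} {N : ℕ}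

theorem conjVertex_zero_eq (h : IsAxialSequence Γ σ η g N) {u : V} (hu : InStar Γ (σ 0).1 u) :
    conjVertex Γ u (η 1) = conjVertex Γ u (η 0) := by
  have := h.succ 0
  rw [zero_add] at this
  rw [this]
  exact conjVertex_mul_of_mem (zpow_mem_starGroup hu.symm _) _

/-- Only finitely many translates meet S, because each vertex lies in finitely many of them. So far
out, disjointness from S comes for free and `ends_of_line` applies. -/
theorem separatesEnds_of_closed [Finite V] (h : IsAxialSequence Γ σ η g N) (hconn : Γ.Connected)
    {S : Set (ExtVertex Γ)} (hSfin : S.Finite) (hSH : S ⊆ (translateUnion Γ η).verts)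
    (P : Set (ExtVertex Γ))
    (hP : ∀ x y, x ∉ S → y ∉ S → (translateUnion Γ η).Adj x y → x ∈ P → y ∈ P)
    (hpos : ∀ m : ℤ, 2 ≤ m → Disjoint (translateGraph Γ (η m)).verts S →
      (translateGraph Γ (η m)).verts ⊆ P)
    (hneg : ∀ m : ℤ, m ≤ -2 → Disjoint (translateGraph Γ (η m)).verts S →
      Disjoint (translateGraph Γ (η m)).verts P) :
    SeparatesEnds (translateUnion Γ η) S := by
  have hfinS : {m | ¬ Disjoint (translateGraph Γ (η m)).verts S}.Finite := by
    refine (hSfin.biUnion fun x _ => h.finite_setOf_mem x).subset fun m hm => ?_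
    obtain ⟨x, hx, hxS⟩ := Set.not_disjoint_iff.1 hm
    exact Set.mem_biUnion hxS hx
  have hev : ∀ f : ℕ → ℤ, f.Injective →
      ∀ᶠ n in Filter.atTop, Disjoint (translateGraph Γ (η (f n))).verts S := by
    intro f hf
    have := (hfinS.preimage hf.injOn).eventually_cofinite_notMem
    rw [Nat.cofinite_eq_atTop] at this
    filter_upwards [this] with n hn
    simpa using hn
  have hTfin := hSfin.preimage (f := (Subtype.val : (translateUnion Γ η).verts → ExtVertex Γ))
    Subtype.val_injective.injOn
  refine ⟨hTfin.toFinset, ?_, ?_⟩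
  · rw [Set.Finite.coe_toFinset, Set.image_preimage_eq_iff, Subtype.range_val]
    exact hSH
  refine SimpleGraph.ends_of_line (fun m => {x | x.1 ∈ (translateGraph Γ (η m)).verts})
    ?_ ?_ ?_ ?_ ?_ _ {x | x.1 ∈ P} ?_ ?_ ?_
  · intro m
    let f : Γ →g (translateUnion Γ η).coe.induce {x | x.1 ∈ (translateGraph Γ (η m)).verts} :=
      { toFun := fun u => ⟨⟨conjVertex Γ u (η m), mem_translateUnion.2 ⟨m, u, rfl⟩⟩, u, rfl⟩
        map_rel' := fun hab => translateUnion_adj.2 ⟨m, translateGraph_adj.2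
          ⟨⟨_, rfl⟩, ⟨_, rfl⟩, adj_conjVertex_iff.2 hab⟩⟩ }
    intro x y
    obtain ⟨a, ha⟩ := x.2
    obtain ⟨b, hb⟩ := y.2
    have hx : x = f a := Subtype.ext (Subtype.ext ha.symm)
    have hy : y = f b := Subtype.ext (Subtype.ext hb.symm)
    rw [hx, hy]
    exact (hconn a b).map f
  · exact fun m => (translateGraph_verts_finite (η m)).preimage Subtype.val_injective.injOn
  · intro m
    refine ⟨⟨conjVertex Γ (σ m).1 (η m), mem_translateUnion.2 ⟨m, _, rfl⟩⟩, ⟨_, rfl⟩, ?_⟩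
    refine ⟨(σ m).1, ?_⟩
    change conjVertex Γ (σ m).1 (η (m + 1)) = _
    rw [h.succ]
    exact conjVertex_mul_of_mem (zpow_mem_starGroup (InStar.refl _) _) _
  · exact fun x => mem_translateUnion.1 x.2
  · exact fun x => h.finite_setOf_mem x.1
  · intro x y hx hy hadj hxP
    rw [Set.Finite.mem_toFinset] at hx hy
    exact hP x.1 y.1 hx hy hadj hxP
  · filter_upwards [hev (fun n => n) Nat.cast_injective, Filter.eventually_ge_atTop 2]
      with n hn hn2 x hx
    exact hpos n (by exact_mod_cast hn2) hn hx
  · filter_upwards [hev (fun n => -n) (neg_injective.comp Nat.cast_injective),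
      Filter.eventually_ge_atTop 2] with n hn hn2
    exact Set.disjoint_left.2 fun x hx hxP =>
      Set.disjoint_left.1 (hneg (-n) (by lia) hn) hx hxP

/-- The translated link of `v₁` separates the ends, if `v₁` is not adjacent to the vertex of the
next syllable or to the vertex of the preceding one. -/
theorem separatesEnds_link [Finite V] (h : IsAxialSequence Γ σ η g N) (hconn : Γ.Connected)
    (hg : 6 ≤ Γ.egirth)
    (hadj : ¬ InStar Γ (σ 0).1 (σ 1).1 ∨ ¬ InStar Γ (σ 0).1 (σ (-1)).1) :
    SeparatesEnds (translateUnion Γ η)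
      ((fun b => conjVertex Γ b (η 0)) '' Γ.neighborSet (σ 0).1) := by
  set v := (σ 0).1 with hv
  set S := (fun b => conjVertex Γ b (η 0)) '' Γ.neighborSet v with hS
  have hk : (σ 0).2 ≠ 0 := (h.reduced 0 1).1
  have hSfin : S.Finite := (Set.toFinite _).image _
  have hSH : S ⊆ (translateUnion Γ η).verts := by
    rintro _ ⟨u, -, rfl⟩
    exact mem_translateUnion.2 ⟨0, u, rfl⟩
  have hnear : ∀ u, InStar Γ v u →
      conjVertex Γ u (η 0) ∈ S ∨ conjVertex Γ u (η 0) = conjVertex Γ v (η 0) := by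
    rintro u (rfl | hu)
    exacts [Or.inr rfl, Or.inl ⟨u, hu, rfl⟩]
  rcases hadj with hadj | hadj
  -- The word is read from index 1, where it starts outside the star of v; both η 0 and η 1
  -- represent the star. The case m = 1 has to be excluded, as Γ^{η 1} contains the wall vertex
  -- itself, which is not in S.
  · have hfar : ∀ m : ℤ, 2 ≤ m → ∀ z ∈ (translateGraph Γ (η m)).verts,
        Commute z.1 (conjVertex Γ v (η 0)).1 → z ∈ S := by
      rintro m hm _ ⟨u, rfl⟩ hc
      obtain ⟨n, rfl⟩ : ∃ n : ℕ, m = 1 + (n + 1 : ℕ) := ⟨m.natAbs - 2, by lia⟩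
      have hc : Commute (conjVertex Γ u (η (1 + (n + 1 : ℕ)))).1 (conjVertex Γ v (η 0)).1 := hc
      rw [← h.syllableProd_window, ← h.conjVertex_zero_eq (InStar.refl _)] at hc
      obtain ⟨h1, h2⟩ := adj_and_eq_of_commute hg (h.reduced 1 (n + 1)) hadj hc
      refine ⟨u, h1, ?_⟩
      change conjVertex Γ u (η 0) = conjVertex Γ u (η (1 + (n + 1 : ℕ)))
      rw [← h.syllableProd_window, ← h.conjVertex_zero_eq (Or.inr h1)]
      exact h2.symm
    refine h.separatesEnds_of_closed hconn hSfin hSH (wallSide Γ v (η 0) (σ 0).2) ?_ ?_ ?_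
    · intro x y _ hy hxy hx
      refine mem_wallSide_of_adj (fun m hm z hz hc => ?_) hy hxy hx
      have hm1 : 0 < m := by
        by_contra hm0
        rw [h.side_of_nonpos (not_lt.1 hm0)] at hm
        exact hk hm.symm
      obtain rfl | hm2 := eq_or_lt_of_le (Int.add_one_le_of_lt hm1)
      · obtain ⟨u, rfl⟩ := hz
        have hc : Commute (conjVertex Γ u (η (0 + 1))).1 (conjVertex Γ v (η 0)).1 := hc
        rw [← h.conjVertex_zero_eq (InStar.refl _)] at hc
        have hu := commute_conjVertex_iff.1 hc
        change conjVertex Γ u (η 1) ∈ S ∨ conjVertex Γ u (η 1) = _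
        rw [h.conjVertex_zero_eq hu]
        exact hnear u hu
      · exact Or.inl (hfar m (by lia) z hz hc)
    · rintro m hm hd _ ⟨u, rfl⟩
      refine conjVertex_mem_wallSide (fun hc => ?_) (h.side_of_pos (by lia))
      exact Set.disjoint_left.1 hd ⟨u, rfl⟩ (hfar m hm _ ⟨u, rfl⟩ hc)
    · rintro m hm -
      refine Set.disjoint_left.2 ?_
      rintro _ ⟨u, rfl⟩ hx
      have := hx.2 _ _ rfl
      rw [h.side_of_nonpos (by lia)] at this
      exact hk this.symm
  · have hfar : ∀ m : ℤ, m ≤ -1 → ∀ z ∈ (translateGraph Γ (η m)).verts,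
        Commute z.1 (conjVertex Γ v (η 0)).1 → z ∈ S := by
      rintro m hm _ ⟨u, rfl⟩ hc
      obtain ⟨n, rfl⟩ : ∃ n : ℕ, m = -(n + 1 : ℕ) := ⟨m.natAbs - 1, by lia⟩
      -- Backwards from index 0, the inverse word starts with the inverse of the preceding syllable,
      -- so m = -1 is already covered.
      have e1 := h.inv_syllableProd_window (-(n + 1 : ℕ)) (n + 1)
      have e2 : invWord (window σ (-(n + 1 : ℕ)) (n + 1)) = ((σ (-1)).1, -(σ (-1)).2) ::
          invWord (window σ (-(n + 1 : ℕ)) n) := by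
        have e3 : -((n + 1 : ℕ) : ℤ) + n = -1 := by push_cast; ring
        rw [window_add, e3]
        simp [window, invWord]
      have hr := (h.reduced (-(n + 1 : ℕ)) (n + 1)).invWord
      rw [← syllableProd_invWord, neg_add_cancel, e2] at e1
      rw [e2] at hr
      have hc : Commute (conjVertex Γ u (η (-(n + 1 : ℕ)))).1 (conjVertex Γ v (η 0)).1 := hc
      rw [e1] at hc
      obtain ⟨h1, h2⟩ := adj_and_eq_of_commute hg hr hadj hc
      rw [← e1] at h2
      exact ⟨u, h1, h2.symm⟩
    -- Here the contact with the wall is controlled on the negative side only, so the closed set is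
    -- the complement of that side.
    refine h.separatesEnds_of_closed hconn hSfin hSH (wallSide Γ v (η 0) 0)ᶜ ?_ ?_ ?_
    · intro x y hx _ hxy hxP hyP
      refine hxP (mem_wallSide_of_adj (fun m hm z hz hc => ?_) hx hxy.symm hyP)
      have hm1 : m ≤ 0 := by
        by_contra hm0
        rw [h.side_of_pos (not_le.1 hm0)] at hm
        exact hk hm
      obtain rfl | hm2 := eq_or_lt_of_le hm1
      · obtain ⟨u, rfl⟩ := hz
        exact hnear u (commute_conjVertex_iff.1 hc)
      · exact Or.inl (hfar m (by lia) z hz hc)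
    · rintro m hm - _ ⟨u, rfl⟩ hx
      have := hx.2 _ _ rfl
      rw [h.side_of_pos (by lia)] at this
      exact hk this
    · rintro m hm hd
      refine Set.disjoint_left.2 ?_
      rintro _ ⟨u, rfl⟩ hx
      refine hx (conjVertex_mem_wallSide (fun hc => ?_) (h.side_of_nonpos (by lia)))
      exact Set.disjoint_left.1 hd ⟨u, rfl⟩ (hfar m (by lia) _ ⟨u, rfl⟩ hc)

end IsAxialSequence

end AxialSequence

/-! ### Axial subgraphs of loxodromic elements -/

section Loxodromic

open RAAG

variable {V : Type u} {Γ : SimpleGraph V}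

/-- Along the multiples of a nonzero exponent fixing a vertex, the displacement vanishes, which
forces translation length zero. -/
theorem IsLoxodromic.eq_zero_of_fixed {g : RAAG Γ}
    (hg : IsLoxodromic (extensionGraph Γ) (MulOpposite.op g)) (u : V) (h : RAAG Γ) (k : ℤ)
    (hk : conjVertex Γ u (h * g ^ k) = conjVertex Γ u h) : k = 0 := by
  by_contra hk0
  obtain ⟨τ, hτ, hlim⟩ := hg
  have h1 : MulOpposite.op g ^ k ∈ MulAction.stabilizer (RAAG Γ)ᵐᵒᵖ (conjVertex Γ u h) := by
    rw [MulAction.mem_stabilizer_iff, op_zpow_smul_conjVertex, hk]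
  have h2 : MulOpposite.op g ^ k.natAbs ∈
      MulAction.stabilizer (RAAG Γ)ᵐᵒᵖ (conjVertex Γ u h) := by
    rw [← zpow_natCast]
    rcases Int.natAbs_eq k with e | e
    · rwa [← e]
    · rw [e, zpow_neg] at h1
      exact inv_mem_iff.1 h1
  have hpos : 0 < k.natAbs := Int.natAbs_pos.2 hk0
  have h3 := (hlim (conjVertex Γ u h)).comp
    (Filter.tendsto_id.const_mul_atTop' hpos : Filter.Tendsto (fun n => k.natAbs * n) _ _)
  have h4 : Filter.Tendsto (fun _ : ℕ => (0 : ℝ)) Filter.atTop (nhds τ) := by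
    refine h3.congr fun n => ?_
    have h5 := MulAction.mem_stabilizer_iff.1 (pow_mem h2 n)
    simp only [Function.comp_apply]
    rw [pow_mul, h5]
    simp
  exact hτ.ne (tendsto_nhds_unique tendsto_const_nhds h4)

/-- The bi-infinite periodic sequence of the syllables of the word `s :: t`. -/
def periodicWord (s : V × ℤ) (t : List (V × ℤ)) (m : ℤ) : V × ℤ :=
  (s :: t).getD (m % ((s :: t).length : ℤ)).toNat s

theorem periodicWord_mem (s : V × ℤ) (t : List (V × ℤ)) (m : ℤ) :
    periodicWord s t m ∈ s :: t := by
  have hpos : (0 : ℤ) < (s :: t).length := by simp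
  have h1 := Int.emod_nonneg m hpos.ne'
  have h2 := Int.emod_lt_of_pos m hpos
  rw [periodicWord, List.getD_eq_getElem _ _ (by lia)]
  exact List.getElem_mem _

theorem periodicWord_zero (s : V × ℤ) (t : List (V × ℤ)) : periodicWord s t 0 = s := by
  simp [periodicWord]

theorem periodicWord_one (s r : V × ℤ) (t : List (V × ℤ)) : periodicWord s (r :: t) 1 = r := by
  have : (1 : ℤ) % ((s :: r :: t).length : ℤ) = 1 :=
    Int.emod_eq_of_lt (by norm_num) (by simp)
  rw [periodicWord, this]
  rfl

theorem periodicWord_neg_one {s r : V × ℤ} {t : List (V × ℤ)} (h : r ∈ t.getLast?) :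
    periodicWord s t (-1) = r := by
  obtain ⟨l, rfl⟩ := List.getLast?_eq_some_iff.1 h
  have : (-1 : ℤ) % ((s :: (l ++ [r])).length : ℤ) = (l.length + 1 : ℕ) := by
    rw [← Int.add_mul_emod_self_right (-1) 1, Int.emod_eq_of_lt] <;> (simp; try lia)
  rw [periodicWord, this, Int.toNat_natCast, List.getD_cons_succ]
  simp

theorem partialPower_succ (s : V × ℤ) (t : List (V × ℤ)) (m : ℤ) :
    partialPower Γ (s :: t) (m + 1) = gen Γ (periodicWord s t m).1 ^ (periodicWord s t m).2 *
      partialPower Γ (s :: t) m := by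
  obtain ⟨N, hN⟩ : ∃ N, (s :: t).length = N := ⟨_, rfl⟩
  have hpos : (0 : ℤ) < N := by rw [← hN]; simp
  have h1 := Int.emod_nonneg m hpos.ne'
  have h2 := Int.emod_lt_of_pos m hpos
  have h3 := Int.emod_add_mul_ediv m N
  obtain ⟨i, hi⟩ := Int.eq_ofNat_of_zero_le h1
  have hlt : i < (s :: t).length := by lia
  have hP : periodicWord s t m = (s :: t)[i] := by
    rw [periodicWord, hN, hi, Int.toNat_natCast, List.getD_eq_getElem _ _ hlt]
  have htake : gen Γ (s :: t)[i].1 ^ (s :: t)[i].2 * syllableProd Γ ((s :: t).take i) =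
      syllableProd Γ ((s :: t).take (i + 1)) := by
    rw [List.take_succ_eq_append_getElem hlt, syllableProd_append, syllableProd_cons,
      syllableProd_nil, one_mul]
  have e : m + 1 = (i + 1 : ℤ) + N * (m / N) := by lia
  rw [hP, partialPower, partialPower, hN, hi, Int.toNat_natCast, ← mul_assoc, htake]
  by_cases hc : i + 1 < N
  · have e1 : (m + 1) % N = (i + 1 : ℕ) := by
      rw [e, Int.add_mul_emod_self_left, Int.emod_eq_of_lt] <;> lia
    have e2 : (m + 1) / N = m / N := by
      rw [e, Int.add_mul_ediv_left _ _ hpos.ne', Int.ediv_eq_zero_of_lt] <;> lia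
    rw [e1, e2, Int.toNat_natCast]
  · have e0 : (i + 1 : ℤ) = N := by lia
    have e1 : (m + 1) % N = 0 := by
      rw [e, Int.add_mul_emod_self_left, e0, Int.emod_self]
    have e2 : (m + 1) / N = m / N + 1 := by
      rw [e, Int.add_mul_ediv_left _ _ hpos.ne', e0, Int.ediv_self hpos.ne', add_comm]
    have e3 : (s :: t).take (i + 1) = s :: t := List.take_of_length_le (by lia)
    rw [e1, e2, e3, Int.toNat_zero, List.take_zero, syllableProd_nil,
      one_mul, add_comm, zpow_add, zpow_one]

theorem partialPower_add_length (s : V × ℤ) (t : List (V × ℤ)) (m : ℤ) :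
    partialPower Γ (s :: t) (m + (s :: t).length) =
      partialPower Γ (s :: t) m * syllableProd Γ (s :: t) := by
  have hpos : ((s :: t).length : ℤ) ≠ 0 := by simp; lia
  rw [partialPower, partialPower, Int.add_emod_right, Int.add_ediv_of_dvd_right dvd_rfl,
    Int.ediv_self hpos, zpow_add_one, mul_assoc]

theorem partialPower_zero (w : List (V × ℤ)) : partialPower Γ w 0 = 1 := by
  simp [partialPower]

/-- A syllable can merge with one at distance N or more only if it commutes with the N - 1 syllables
following it; a whole window of length N would then lie in its star. -/
theorem reducedWord_window {σ : ℤ → V × ℤ} {N : ℕ} (hN : 0 < N)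
    (hred : ∀ m, ReducedWord Γ (window σ m N))
    (hstar : ∀ m v, ¬ ∀ s ∈ window σ m N, InStar Γ v s.1) (m : ℤ) (n : ℕ) :
    ReducedWord Γ (window σ m n) := by
  obtain ⟨N, rfl⟩ : ∃ M, N = M + 1 := ⟨N - 1, by lia⟩
  induction n generalizing m with
  | zero => trivial
  | succ n ih =>
    have h1 := hred m
    rw [window] at h1 ⊢
    refine ⟨h1.1, ?_, ih _⟩
    rcases le_total n N with hn | hn
    · obtain ⟨r, rfl⟩ := Nat.exists_eq_add_of_le hn
      have h2 := h1.2.1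
      rw [window_add, unreachable_append] at h2
      exact h2.1
    · obtain ⟨r, rfl⟩ := Nat.exists_eq_add_of_le hn
      rw [window_add, unreachable_append]
      refine ⟨h1.2.1, fun hadj => absurd ?_ (hstar m (σ m).1)⟩
      rw [window]
      exact List.forall_mem_cons.2 ⟨InStar.refl _, fun s hs => Or.inr (hadj s hs)⟩

variable {g g₀ c : RAAG Γ}

theorem notMem_starGroup_of_not_fixed (hc : g₀ * c = c * g)
    (hfix : ∀ (u : V) (h : RAAG Γ) (k : ℤ), conjVertex Γ u (h * g ^ k) = conjVertex Γ u h → k = 0)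
    (v : V) : g₀ ∉ starGroup Γ v := by
  intro hm
  have := hfix v c 1 (by rw [zpow_one, ← hc, conjVertex_mul_of_mem hm])
  exact one_ne_zero this

/-- The partial powers of a cyclically syllable-reduced element form an axial sequence. -/
theorem isAxialSequence_partialPower (hcyc : IsCyclicallySyllableReduced g₀) (hc : g₀ * c = c * g)
    (hfix : ∀ (u : V) (h : RAAG Γ) (k : ℤ), conjVertex Γ u (h * g ^ k) = conjVertex Γ u h → k = 0)
    {s : V × ℤ} {t : List (V × ℤ)} (hw : IsSyllableDecomposition (s :: t) g₀) :
    IsAxialSequence Γ (periodicWord s t) (fun m => partialPower Γ (s :: t) m * c) g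
      (s :: t).length := by
  have hsucc : ∀ m, partialPower Γ (s :: t) (m + 1) * c =
      gen Γ (periodicWord s t m).1 ^ (periodicWord s t m).2 *
        (partialPower Γ (s :: t) m * c) := by
    intro m
    rw [partialPower_succ, mul_assoc]
  have hprod : ∀ m, syllableProd Γ (window (periodicWord s t) m (s :: t).length) =
      partialPower Γ (s :: t) m * g₀ * (partialPower Γ (s :: t) m)⁻¹ := by
    intro m
    have := syllableProd_window_mul (partialPower_succ (Γ := Γ) s t) m (s :: t).length
    rw [partialPower_add_length, hw.prod_eq] at this
    exact eq_mul_inv_of_mul_eq this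
  have hne : ∀ m n, ∀ r ∈ window (periodicWord s t) m n, r.2 ≠ 0 := by
    intro m n
    induction n generalizing m with
    | zero => simp [window]
    | succ n ih =>
      rw [window]
      exact List.forall_mem_cons.2 ⟨hw.exponent_ne_zero _ (periodicWord_mem s t m), ih _⟩
  refine ⟨by simp, hsucc, fun m => ?_, ?_, hfix⟩
  · rw [partialPower_add_length, hw.prod_eq, mul_assoc, mul_assoc, hc]
  · refine reducedWord_window (N := (s :: t).length) (by simp) (fun m => ?_) (fun m v hv => ?_)
    -- A window of one period is a conjugate of g₀, so its N syllables cannot be reduced in number.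
    · refine reducedWord_of_length_le (hne _ _) ?_
      rw [length_window, hprod, hw.length_eq]
      simpa using hcyc (partialPower Γ (s :: t) m)⁻¹
    -- A full period inside a star would make g fix a vertex.
    · have h1 := syllableProd_mem_starGroup hv
      rw [hprod] at h1
      have h2 := hfix v (partialPower Γ (s :: t) m * c) 1 (by
        rw [zpow_one, ← conjVertex_mul_of_mem h1 (partialPower Γ (s :: t) m * c), mul_assoc, ← hc]
        congr 1
        group)
      exact one_ne_zero h2

theorem separatesEnds_of_not_adj [Finite V] (hconn : Γ.Connected) (hg : 6 ≤ Γ.egirth)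
    (hcyc : IsCyclicallySyllableReduced g₀) (hc : g₀ * c = c * g)
    (hfix : ∀ (u : V) (h : RAAG Γ) (k : ℤ), conjVertex Γ u (h * g ^ k) = conjVertex Γ u h → k = 0)
    {s : V × ℤ} {t : List (V × ℤ)} (hw : IsSyllableDecomposition (s :: t) g₀)
    (hadj : ∃ r : V × ℤ, (r ∈ t.head? ∨ r ∈ t.getLast?) ∧ ¬ Γ.Adj s.1 r.1) :
    SeparatesEnds (translateUnion Γ fun m => partialPower Γ (s :: t) m * c)
      ((fun b => conjVertex Γ b c) '' Γ.neighborSet s.1) := by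
  have h := isAxialSequence_partialPower hcyc hc hfix hw
  have key := h.separatesEnds_link hconn hg
  simp only [periodicWord_zero, partialPower_zero, one_mul] at key
  refine key ?_
  obtain ⟨r, hr | hr, hadj⟩ := hadj
  · obtain ⟨t, rfl⟩ : ∃ t', t = r :: t' := by
      rcases t with - | ⟨a, t⟩
      · simp at hr
      · exact ⟨t, by simpa using hr⟩
    rw [periodicWord_one]
    -- Neighbouring syllables of a reduced word have distinct vertices, so not adjacent means
    -- outside the closed star.
    have h1 := (h.reduced 0 2).2.1.1
    rw [zero_add, periodicWord_one, periodicWord_zero] at h1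
    exact Or.inl fun h2 => h2.elim h1 hadj
  · rw [periodicWord_neg_one hr]
    have h1 := (h.reduced (-1) 2).2.1.1
    rw [neg_add_cancel, periodicWord_neg_one hr, periodicWord_zero] at h1
    exact Or.inr fun h2 => h2.elim h1.symm hadj

theorem exists_separatesEnds [Finite V] (hconn : Γ.Connected) (hg : 6 ≤ Γ.egirth)
    (hcyc : IsCyclicallySyllableReduced g₀) (hc : g₀ * c = c * g)
    (hfix : ∀ (u : V) (h : RAAG Γ) (k : ℤ),
      conjVertex Γ u (h * g ^ k) = conjVertex Γ u h → k = 0) :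
    ∃ (s : V × ℤ) (t : List (V × ℤ)), IsSyllableDecomposition (s :: t) g₀ ∧
      SeparatesEnds (translateUnion Γ fun m => partialPower Γ (s :: t) m * c)
        ((fun b => conjVertex Γ b c) '' Γ.neighborSet s.1) := by
  have hstar := notMem_starGroup_of_not_fixed hc hfix
  have sep := fun {s t} => @separatesEnds_of_not_adj V Γ g g₀ c _ hconn hg hcyc hc hfix s t
  obtain ⟨w, hw⟩ := exists_isSyllableDecomposition g₀
  obtain ⟨v₀⟩ := hconn.nonempty
  match w, hw with
  | [], hw => exact absurd (hw.prod_eq ▸ one_mem _) (hstar v₀)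
  | [s], hw =>
    refine absurd ?_ (hstar s.1)
    rw [← hw.prod_eq]
    exact syllableProd_mem_starGroup (by simp [InStar.refl])
  | [s, r], hw =>
    refine ⟨s, _, hw, sep hw ⟨r, by simp, fun h => hstar s.1 ?_⟩⟩
    rw [← hw.prod_eq]
    exact syllableProd_mem_starGroup (by simp [InStar, h])
  | s :: r :: a :: t, hw =>
    by_cases hsr : Γ.Adj s.1 r.1
    · set l := (a :: t).getLast (List.cons_ne_nil _ _) with hl
      have hl1 : l ∈ (r :: a :: t).getLast? := by
        simp [hl, List.getLast?_eq_some_getLast]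
      have hl2 : l ∈ (s :: a :: t).getLast? := by
        simp [hl, List.getLast?_eq_some_getLast]
      by_cases hsl : Γ.Adj s.1 l.1
      -- The first syllable commutes with both cyclic neighbours. After exchanging it with the
      -- second, the new first vertex is not adjacent to the last one, as the three would form a
      -- triangle.
      · have hw' : IsSyllableDecomposition (r :: s :: a :: t) g₀ := by
          refine ⟨fun x hx => hw.exponent_ne_zero x ?_, ?_, ?_⟩
          · simp only [List.mem_cons] at hx ⊢
            tauto
          · rw [← hw.prod_eq]
            simp only [syllableProd_cons, mul_assoc]
            rw [((gen_commute hsr).zpow_zpow s.2 r.2).eq]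
          · rw [← hw.length_eq]
            rfl
        exact ⟨r, _, hw', sep hw' ⟨l, Or.inr hl2, fun h =>
          SimpleGraph.not_triangle_of_six_le_egirth hg hsr h hsl.symm⟩⟩
      · exact ⟨s, _, hw, sep hw ⟨l, Or.inr hl1, hsl⟩⟩
    · exact ⟨s, _, hw, sep hw ⟨r, by simp, hsr⟩⟩

theorem exists_conj_isCyclicallySyllableReduced (g : RAAG Γ) :
    ∃ c : RAAG Γ, IsCyclicallySyllableReduced (c * g * c⁻¹) := by
  obtain ⟨c, hc⟩ : ∃ c : RAAG Γ, ∀ d : RAAG Γ,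
      syllableLength (c * g * c⁻¹) ≤ syllableLength (d * g * d⁻¹) :=
    ⟨Function.argmin fun c => syllableLength (c * g * c⁻¹), 
      fun d => Function.argmin_le (fun c => syllableLength (c * g * c⁻¹)) d⟩
  refine ⟨c, fun h => ?_⟩
  convert hc (h⁻¹ * c) using 2
  group

theorem translateUnion_partialPower (w : List (V × ℤ)) :
    (translateUnion Γ fun m => partialPower Γ w m * 1) = axialUnion Γ w := by
  simp only [mul_one]
  rfl

end Loxodromic

theorem mainTheorem4 {V : Type u} [Fintype V] (Γ : SimpleGraph V) [DecidableRel Γ.Adj]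
    (hconn : Γ.Connected) (hgirth : 6 ≤ Γ.egirth) :
    (∃ κ : ℕ, κ ≤ max 1 Γ.maxDegree ∧
      HasKappaFiniteness (RAAG Γ)ᵐᵒᵖ (extensionGraph Γ) κ) ∧
    (∀ g : RAAG Γ, IsCyclicallySyllableReduced g →
      IsLoxodromic (extensionGraph Γ) (MulOpposite.op g) →
        (∀ w : List (V × ℤ), IsSyllableDecomposition w g →
          IsAxialSubgraph (extensionGraph Γ) (MulOpposite.op g) (axialUnion Γ w)) ∧
        (∀ (v₁ : V) (k₁ : ℤ) (t : List (V × ℤ)),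
          IsSyllableDecomposition ((v₁, k₁) :: t) g →
          (∃ s : V × ℤ, (s ∈ t.head? ∨ s ∈ t.getLast?) ∧ ¬ Γ.Adj v₁ s.1) →
          SeparatesEnds (axialUnion Γ ((v₁, k₁) :: t)) (linkSet Γ v₁)) ∧
        (∃ (v₁ : V) (k₁ : ℤ) (t : List (V × ℤ)),
          IsSyllableDecomposition ((v₁, k₁) :: t) g ∧
          SeparatesEnds (axialUnion Γ ((v₁, k₁) :: t)) (linkSet Γ v₁))) := by
  refine ⟨⟨max 1 Γ.maxDegree, le_rfl, actsSimplicially_extensionGraph Γ,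
    exists_isDeltaHyperbolic_extensionGraph hconn, by simp, fun γ hγ => ?_⟩,
    fun g hcyc hlox => ?_⟩
  · obtain ⟨g, rfl⟩ := MulOpposite.op_surjective γ
    obtain ⟨c, hcyc⟩ := exists_conj_isCyclicallySyllableReduced g
    -- The sequence is built from a cyclically reduced conjugate and translated by c, so the
    -- subgraph is axial for g itself and the separating set is a translated link.
    have hc : c * g * c⁻¹ * c = c * g := inv_mul_cancel_right _ _
    obtain ⟨s, t, hw, hsep⟩ := exists_separatesEnds hconn hgirth hcyc hc hγ.eq_zero_of_fixed
    refine ⟨_, (isAxialSequence_partialPower hcyc hc hγ.eq_zero_of_fixed hw).isAxialSubgraph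
      hconn hgirth, (iInf₂_le _ hsep).trans ((Set.encard_image_le _ _).trans ?_)⟩
    rw [← SimpleGraph.coe_neighborFinset, Set.encard_coe_eq_coe_finsetCard]
    exact_mod_cast (Γ.degree_le_maxDegree s.1).trans (le_max_right _ _)
  · have hc : g * 1 = 1 * g := by simp
    have hfix := hlox.eq_zero_of_fixed
    refine ⟨fun w hw => ?_, fun v₁ k₁ t hw hadj => ?_, ?_⟩
    · rcases w with - | ⟨s, t⟩
      · obtain ⟨v₀⟩ := hconn.nonempty
        exact absurd (hw.prod_eq ▸ one_mem _) (notMem_starGroup_of_not_fixed hc hfix v₀)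
      · rw [← translateUnion_partialPower]
        exact (isAxialSequence_partialPower hcyc hc hfix hw).isAxialSubgraph hconn hgirth
    · rw [← translateUnion_partialPower]
      exact separatesEnds_of_not_adj hconn hgirth hcyc hc hfix hw hadj
    · obtain ⟨s, t, hw, hsep⟩ := exists_separatesEnds hconn hgirth hcyc hc hfix
      rw [translateUnion_partialPower] at hsep
      exact ⟨s.1, s.2, t, hw, hsep⟩
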